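/- **Setting.** Let $d\in\{2,3\}$, let $\Omega\subseteq\mathbb R^d$ be an open set with $\Omega=\operatorname{int}(\overline\Omega)$ (for instance a Lipschitz domain) and boundary $\Gamma=\partial\Omega$, and let $\mathcal T_\Omega$ be a (finite, conforming, simplicial) triangulation of $\overline\Omega$ with maximal mesh width $h=\max_{T\in\mathcal T_\Omega}\operatorname{diam}T$. The triangulation is quasi-uniform with parameter $\kappa>0$ if every element $T\in\mathcal T_\Omega$ contains a ball of radius $h/\kappa$. Let $\alpha\in L^\infty(\Omega)$ be a uniformly positive diffusion coefficient, with $\alpha\le A$ almost everywhere. For $k\ge1$ let $\mathbb V_h=\mathcal P_k(\mathcal T_\Omega)$ be the space of continuous functions on $\overline\Omega$ that are polynomials of degree at most $k$ on every element, with Lagrange nodes $z_a$ (the points whose barycentric coordinates in an element are multiples of $1/k$) and nodal basis $\varphi_a$, $\varphi_a(z_b)=\delta_{ab}$. Let $\mathbb M_h$ be a space of functions on $\Gamma$, spanned by $\mu_1,\dots,\mu_{N_\lambda}$, with $\mathbb V_h|_\Gamma=\mathbb M_h$, and let $\mathbb Q_h\subseteq L^2(\Gamma)$ be spanned by $\psi_1,\dots,\psi_{N_p}$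 (in particular, $\mathbb Q_h$ may be any conforming finite element space $\mathbb Q_h\subseteq H^1(\Gamma)$). Define $$(M_u)_{ab}=\int_\Omega\varphi_a\varphi_b\,dx,\quad (K_u)_{ab}=\int_\Omega\alpha\,\nabla\varphi_a\cdot\nabla\varphi_b\,dx,\quad (M_p)_{ij}=\int_\Gamma\psi_i\psi_j\,ds,$$ $$(B_u)_{ia}=\int_\Gamma\mu_i\,\varphi_a\,ds,\qquad (B_p)_{ij}=\int_\Gamma\mu_i\,\psi_j\,ds .$$ For a coefficient vector $u$ of a function in $\mathbb V_h$ let $u_2$ be the part of $u$ that belongs to the nodes on $\Gamma$, and let $M_{22}$, $K_{22}$ be the corresponding diagonal blocks of $M_u$, $K_u$. For a square matrix $M$ write $\|x\|_M^2=x^{\mathsf T}Mx$. **Lemma.** For all $k\ge 1$ and $\kappa>0$ there is a constant $c_M>0$, depending only on $k$ and $\kappa$, and for all $k\ge1$, $\kappa>0$ and $A>0$ there is a constant $c_K>0$, depending only on $k$, $\kappa$ and $A$, such that the following holds in the above setting for every $\Omega$, every triangulation $\mathcal T_\Omega$ that is quasi-uniform with parameter $\kappa$, every such $\alpha\le A$,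 and all such $\mathbb M_h$, $\mathbb Q_h$ (the constants do not depend on $h$): if the coefficient vectors $u\in\mathbb R^{N_u}$ and $p\in\mathbb R^{N_p}$ satisfy $B_uu=B_pp$, then $$\|u_2\|_{M_{22}}^2\le c_M\,h\,\|p\|_{M_p}^2\qquad\text{and}\qquad \|u_2\|_{K_{22}}^2\le c_K\,h^{-1}\,\|p\|_{M_p}^2 .$$ -/

import Mathlib

open MeasureTheory
open scoped Gradient

noncomputable section

namespace BulkSurface

/-- A conforming simplicial triangulation of the domain `Ω ⊆ ℝ^d`: a finite geometric simplicial
complex, all of whose maximal simplices are `d`-dimensional, with underlying set `closure Ω`.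
(Simplices are recorded by their vertex sets.) -/
structure Triangulation (d : ℕ) (Ω : Set (EuclideanSpace ℝ (Fin d))) extends
    Geometry.SimplicialComplex ℝ (EuclideanSpace ℝ (Fin d)) where
  finite_faces : faces.Finite
  pure : ∀ s ∈ faces, ∃ t ∈ faces, s ⊆ t ∧ t.card = d + 1
  closure_eq : closure Ω = toSimplicialComplex.space

namespace Triangulation

variable {d : ℕ} {Ω : Set (EuclideanSpace ℝ (Fin d))} (T : Triangulation d Ω)

/-- The elements of the triangulation, i.e. its `d`-dimensional simplices. -/
def cells : Set (Finset (EuclideanSpace ℝ (Fin d))) := {s | s ∈ T.faces ∧ s.card = d + 1}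

/-- The maximal mesh width `h`, the largest diameter of an element. -/
def meshWidth : ℝ :=
  sSup ((fun s : Finset (EuclideanSpace ℝ (Fin d)) =>
    Metric.diam (convexHull ℝ (s : Set (EuclideanSpace ℝ (Fin d))))) '' T.cells)

/-- Quasi-uniformity with parameter `κ`: every element contains a ball of radius `h / κ`. -/
def QuasiUniform (κ : ℝ) : Prop :=
  ∀ s ∈ T.cells, ∃ c : EuclideanSpace ℝ (Fin d),
    Metric.closedBall c (T.meshWidth / κ) ⊆ convexHull ℝ (s : Set (EuclideanSpace ℝ (Fin d)))

/-- The conforming finite element space `𝒫_k(T)`: continuous functions on `closure Ω` (extended by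
zero) whose restriction to each element is a polynomial of total degree at most `k`. -/
def lagrangeSpace (k : ℕ) : Submodule ℝ (EuclideanSpace ℝ (Fin d) → ℝ) where
  carrier := {v | ContinuousOn v (closure Ω) ∧ (∀ x ∉ closure Ω, v x = 0) ∧
    ∀ s ∈ T.cells, ∃ q : MvPolynomial (Fin d) ℝ, q.totalDegree ≤ k ∧
      ∀ x ∈ convexHull ℝ (s : Set (EuclideanSpace ℝ (Fin d))),
        v x = MvPolynomial.eval (fun i => x i) q}
  add_mem' := by
    rintro v w ⟨hv, hv0, hv'⟩ ⟨hw, hw0, hw'⟩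
    refine ⟨hv.add hw, fun x hx => by simp [hv0 x hx, hw0 x hx], fun s hs => ?_⟩
    obtain ⟨q, hq, hvq⟩ := hv' s hs
    obtain ⟨r, hr, hwr⟩ := hw' s hs
    exact ⟨q + r, (MvPolynomial.totalDegree_add q r).trans (max_le hq hr),
      fun x hx => by simp [hvq x hx, hwr x hx]⟩
  zero_mem' := ⟨continuousOn_const, fun _ _ => rfl, fun _ _ => ⟨0, by simp, fun _ _ => by simp⟩⟩
  smul_mem' := by
    rintro c v ⟨hv, hv0, hv'⟩
    refine ⟨hv.const_smul c, fun x hx => by simp [hv0 x hx], fun s hs => ?_⟩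
    obtain ⟨q, hq, hvq⟩ := hv' s hs
    exact ⟨c • q, (MvPolynomial.totalDegree_smul_le c q).trans hq,
      fun x hx => by simp [hvq x hx, MvPolynomial.smul_eval]⟩

/-- `w` is a system of barycentric coordinates of the point `x` with respect to the vertices of the
triangulation, supported on the vertices of one simplex. -/
def IsBary (x : EuclideanSpace ℝ (Fin d)) (w : EuclideanSpace ℝ (Fin d) →₀ ℝ) : Prop :=
  (∀ v, 0 ≤ w v) ∧ w.support ∈ T.faces ∧ (w.sum fun _ c => c) = 1 ∧ (w.sum fun v c => c • v) = x

open Classical in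
/-- The barycentric coordinates of `x` (unique for `x ∈ closure Ω`), and zero off `closure Ω`. For
fixed `v`, the map `x ↦ T.bary x v` is the piecewise linear hat function of the vertex `v`. -/
def bary (x : EuclideanSpace ℝ (Fin d)) : EuclideanSpace ℝ (Fin d) →₀ ℝ :=
  if h : ∃ w, T.IsBary x w then h.choose else 0

/-- The Lagrange nodes of degree `k`, as multi-indices `a` with `∑ a_v = k` on the vertices of a
simplex; `a` stands for the point with barycentric coordinates `a_v / k`. -/
def Node (k : ℕ) : Type :=
  {a : EuclideanSpace ℝ (Fin d) →₀ ℕ // a.support ∈ T.faces ∧ (a.sum fun _ m => m) = k}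

instance (k : ℕ) : Finite (T.Node k) := by
  classical
  refine Set.Finite.to_subtype (s := {a : EuclideanSpace ℝ (Fin d) →₀ ℕ |
    a.support ∈ T.faces ∧ (a.sum fun _ m => m) = k}) ?_
  refine Set.Finite.subset
    (T.finite_faces.toFinset.biUnion fun s => Finset.finsuppAntidiag s k).finite_toSet ?_
  rintro a ⟨ha, hk⟩
  simp only [Finset.coe_biUnion, Set.mem_iUnion, Finset.mem_coe, Finset.mem_finsuppAntidiag]
  exact ⟨a.support, by simpa using ha, hk, subset_rfl⟩

instance (k : ℕ) : Fintype (T.Node k) := Fintype.ofFinite _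

variable {T} in
/-- The position of a Lagrange node. -/
def Node.point {k : ℕ} (a : T.Node k) : EuclideanSpace ℝ (Fin d) :=
  a.1.sum fun v m => ((m : ℝ) / k) • v

/-- The Lagrange nodes on the boundary `Γ = ∂Ω`. -/
def BoundaryNode (k : ℕ) : Type := {a : T.Node k // a.point ∈ frontier Ω}

instance (k : ℕ) : Fintype (T.BoundaryNode k) :=
  @Fintype.ofFinite _ (inferInstanceAs (Finite {a : T.Node k // a.point ∈ frontier Ω}))

/-- The Lagrange nodal basis function of `𝒫_k(T)` belonging to the node `a`,
`∏_v (1 / a_v!) ∏_{j < a_v} (k λ_v - j)` with the barycentric coordinates `λ_v`. -/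
def nodalBasis (k : ℕ) (a : T.Node k) (x : EuclideanSpace ℝ (Fin d)) : ℝ :=
  a.1.prod fun v m => ∏ j ∈ Finset.range m, ((k : ℝ) * T.bary x v - j) / (j + 1)

section facts
variable {T}

/-- Barycentric coordinates are unique. -/
theorem IsBary.unique {x : EuclideanSpace ℝ (Fin d)} {w w' : EuclideanSpace ℝ (Fin d) →₀ ℝ}
    (hw : T.IsBary x w) (hw' : T.IsBary x w') : w = w' := by
  classical
  obtain ⟨h0, hs, h1, hx⟩ := hw
  obtain ⟨h0', hs', h1', hx'⟩ := hw'
  have m : ∀ {w : EuclideanSpace ℝ (Fin d) →₀ ℝ}, (∀ v, 0 ≤ w v) → (w.sum fun _ c => c) = 1 →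
      (w.sum fun v c => c • v) = x →
      x ∈ convexHull ℝ (w.support : Set (EuclideanSpace ℝ (Fin d))) := by
    intro w h0 h1 hx
    rw [Finset.mem_convexHull']
    exact ⟨w, fun v _ => h0 v, h1, hx⟩
  have key := T.inter_subset_convexHull hs hs' ⟨m h0 h1 hx, m h0' h1' hx'⟩
  rw [← Finset.coe_inter, Finset.mem_convexHull'] at key
  obtain ⟨y, hy0, hy1, hyx⟩ := key
  have gen : ∀ {w : EuclideanSpace ℝ (Fin d) →₀ ℝ} (t : Finset (EuclideanSpace ℝ (Fin d))),
      w.support ∈ T.faces → t ⊆ w.support → (w.sum fun _ c => c) = 1 →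
      (w.sum fun v c => c • v) = x → (∑ v ∈ t, y v = 1) → (∑ v ∈ t, y v • v = x) →
      ∀ v, w v = if v ∈ t then y v else 0 := by
    intro w t hs hts h1 hx hy1 hyx v
    by_cases hv : v ∈ w.support
    · have ind := T.indep hs
      have := (affineIndependent_iff.1 ind) Finset.univ
        (fun v => w v - if (v : EuclideanSpace ℝ (Fin d)) ∈ t then y v else 0) ?_ ?_ ⟨v, hv⟩
        (Finset.mem_univ _)
      · exact sub_eq_zero.1 this
      · rw [Finset.univ_eq_attach, Finset.sum_attach w.support
          (fun v => w v - if v ∈ t then y v else 0), Finset.sum_sub_distrib,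
          Finset.sum_ite_mem, Finset.inter_eq_right.2 hts, hy1, ← h1]
        simp [Finsupp.sum]
      · rw [Finset.univ_eq_attach, Finset.sum_attach w.support
          (fun v => (w v - if v ∈ t then y v else 0) • v)]
        simp only [sub_smul, ite_smul, zero_smul]
        rw [Finset.sum_sub_distrib, Finset.sum_ite_mem, Finset.inter_eq_right.2 hts, hyx, ← hx]
        simp [Finsupp.sum]
    · rw [if_neg (fun h => hv (hts h)), Finsupp.notMem_support_iff.1 hv]
  ext v
  rw [gen _ hs Finset.inter_subset_left h1 hx hy1 hyx,
    gen _ hs' Finset.inter_subset_right h1' hx' hy1 hyx]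

theorem IsBary.bary_eq {x : EuclideanSpace ℝ (Fin d)} {w : EuclideanSpace ℝ (Fin d) →₀ ℝ}
    (hw : T.IsBary x w) : T.bary x = w := by
  have h : ∃ w, T.IsBary x w := ⟨w, hw⟩
  rw [bary, dif_pos h]
  exact h.choose_spec.unique hw

theorem Node.isBary {k : ℕ} (hk : 1 ≤ k) (a : T.Node k) :
    T.IsBary a.point (a.1.mapRange (fun m : ℕ => (m : ℝ) / k) (by simp)) := by
  have hk' : (k : ℝ) ≠ 0 := by positivity
  have hsupp : (a.1.mapRange (fun m : ℕ => (m : ℝ) / k) (by simp)).support = a.1.support := by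
    ext v; simp [hk']
  refine ⟨fun v => by rw [Finsupp.mapRange_apply]; positivity, by rw [hsupp]; exact a.2.1, ?_, ?_⟩
  · rw [Finsupp.sum_mapRange_index (by simp), Finsupp.sum, ← Finset.sum_div, ← Nat.cast_sum,
      div_eq_one_iff_eq hk']
    exact_mod_cast a.2.2
  · rw [Finsupp.sum_mapRange_index (by simp)]; rfl

/-- The nodal basis functions satisfy `φ_a(z_b) = δ_{ab}`. -/
theorem nodalBasis_point {k : ℕ} (hk : 1 ≤ k) (a b : T.Node k) [Decidable (a = b)] :
    T.nodalBasis k a b.point = if a = b then 1 else 0 := by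
  have hk' : (k : ℝ) ≠ 0 := by positivity
  have hval : ∀ v, (k : ℝ) * T.bary b.point v = b.1 v := fun v => by
    rw [(b.isBary hk).bary_eq]; simp; field_simp
  unfold nodalBasis
  simp only [hval]
  split_ifs with hab
  · subst hab
    refine Finset.prod_eq_one fun v _ => ?_
    change ∏ j ∈ Finset.range (a.1 v), ((a.1 v : ℝ) - j) / ((j : ℝ) + 1) = 1
    rw [Finset.prod_div_distrib]
    have h1 : ∏ j ∈ Finset.range (a.1 v), ((a.1 v : ℝ) - j) = ((a.1 v).factorial : ℝ) := by
      rw [← Nat.descFactorial_self, Nat.descFactorial_eq_prod_range, Nat.cast_prod]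
      refine Finset.prod_congr rfl fun j hj => ?_
      rw [Nat.cast_sub (Finset.mem_range.1 hj).le]
    have h2 : ∏ j ∈ Finset.range (a.1 v), ((j : ℝ) + 1) = ((a.1 v).factorial : ℝ) := by
      rw [← Finset.prod_range_add_one_eq_factorial]; push_cast; rfl
    rw [h1, h2, div_self (by positivity)]
  · have : ∃ v, b.1 v < a.1 v := by
      by_contra! hle
      apply hab
      have hle' : a.1 ≤ b.1 := hle
      have hadd : a.1 + (b.1 - a.1) = b.1 := add_tsub_cancel_of_le hle'
      have hs : (b.1.sum fun _ m => m) = (a.1.sum fun _ m => m) +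
          ((b.1 - a.1).sum fun _ m => m) := by
        conv_lhs => rw [← hadd]
        exact Finsupp.sum_add_index' (fun _ => rfl) (fun _ _ _ => rfl)
      rw [a.2.2, b.2.2] at hs
      have hz : ((b.1 - a.1).sum fun _ m => m) = 0 := by omega
      have hz' : b.1 - a.1 = 0 := by
        ext v
        by_contra hv
        have := (Finset.sum_eq_zero_iff.1 hz) v (Finsupp.mem_support_iff.2 hv)
        exact hv this
      apply Subtype.ext
      rw [← hadd, hz', add_zero]
    obtain ⟨v, hv⟩ := this
    refine Finset.prod_eq_zero (i := v) (Finsupp.mem_support_iff.2 (by omega)) ?_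
    refine Finset.prod_eq_zero (i := b.1 v) (Finset.mem_range.2 hv) (by simp)

/-- On an element, the barycentric coordinates are affine functions. -/
theorem exists_affine {s : Finset (EuclideanSpace ℝ (Fin d))} (hs : s ∈ T.cells)
    (v : EuclideanSpace ℝ (Fin d)) :
    ∃ q : MvPolynomial (Fin d) ℝ, q.totalDegree ≤ 1 ∧
      ∀ x ∈ convexHull ℝ (s : Set (EuclideanSpace ℝ (Fin d))),
        T.bary x v = MvPolynomial.eval (fun i => x i) q := by
  classical
  have hw : ∀ x ∈ convexHull ℝ (s : Set (EuclideanSpace ℝ (Fin d))),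
      ∃ w : EuclideanSpace ℝ (Fin d) → ℝ, ∑ y ∈ s, w y = 1 ∧ ∑ y ∈ s, w y • y = x ∧
        ∀ v, T.bary x v = if v ∈ s then w v else 0 := by
    intro x hx
    obtain ⟨w, h0, h1, hx⟩ := Finset.mem_convexHull'.1 hx
    let f : EuclideanSpace ℝ (Fin d) →₀ ℝ :=
      Finsupp.onFinset s (fun v => if v ∈ s then w v else 0) (by
        intro v hv; by_contra h; exact hv (if_neg h))
    have hfs : f.support ⊆ s := Finsupp.support_onFinset_subset
    have hf1 : (f.sum fun _ c => c) = 1 := by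
      rw [Finsupp.sum_of_support_subset f hfs _ (by simp), ← h1]
      exact Finset.sum_congr rfl fun v hv => if_pos hv
    have hfx : (f.sum fun v c => c • v) = x := by
      rw [Finsupp.sum_of_support_subset f hfs _ (by simp), ← hx]
      exact Finset.sum_congr rfl fun v hv => by
        change (if v ∈ s then w v else 0) • v = _
        rw [if_pos hv]
    have hne : f.support.Nonempty := by
      rw [Finset.nonempty_iff_ne_empty]
      intro h
      rw [Finsupp.support_eq_empty.1 h] at hf1
      simp at hf1
    have hb : T.IsBary x f := by
      refine ⟨fun v => ?_, T.down_closed hs.1 hfs hne, hf1, hfx⟩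
      change 0 ≤ if v ∈ s then w v else 0
      split_ifs with h
      · exact h0 v h
      · exact le_rfl
    exact ⟨w, h1, hx, fun v => by rw [hb.bary_eq]; rfl⟩
  by_cases hv : v ∈ s
  · have htop : affineSpan ℝ (Set.range ((↑) : s → EuclideanSpace ℝ (Fin d))) = ⊤ := by
      rw [(T.indep hs.1).affineSpan_eq_top_iff_card_eq_finrank_add_one]
      simp [hs.2]
    let b : AffineBasis s ℝ (EuclideanSpace ℝ (Fin d)) := ⟨(↑), T.indep hs.1, htop⟩
    let f := b.coord ⟨v, hv⟩
    have hf : ∀ x, f x = ∑ i, x i * f.linear (EuclideanSpace.single i 1) + f 0 := by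
      intro x
      have h1 : f x = f.linear x + f 0 := by
        have := f.map_vadd 0 x
        simpa using this
      rw [h1]
      congr 1
      have h2 : x = ∑ i, x i • EuclideanSpace.single i (1 : ℝ) := by
        ext j; simp [Finset.sum_apply, Pi.single_apply]
      conv_lhs => rw [h2]
      simp
    refine ⟨∑ i, MvPolynomial.X i * MvPolynomial.C (f.linear (EuclideanSpace.single i 1)) +
      MvPolynomial.C (f 0), ?_, ?_⟩
    · refine (MvPolynomial.totalDegree_add _ _).trans (max_le ?_ (by simp))
      refine MvPolynomial.totalDegree_finsetSum_le fun i _ => ?_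
      refine (MvPolynomial.totalDegree_mul _ _).trans ?_
      simp
    · intro x hx
      obtain ⟨w, h1, hx', hb⟩ := hw x hx
      have : f x = w v := by
        have hc := b.coord_apply_combination_of_mem (i := ⟨v, hv⟩) (s := Finset.univ)
          (Finset.mem_univ _) (w := fun y => w y)
          (by rw [Finset.univ_eq_attach, Finset.sum_attach s w, h1])
        have h3 : Finset.univ.affineCombination ℝ b (fun y : s => w y) = x := by
          rw [Finset.affineCombination_eq_linear_combination _ _ _
            (by rw [Finset.univ_eq_attach, Finset.sum_attach s w, h1]), ← hx',
            Finset.univ_eq_attach]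
          exact Finset.sum_attach s (fun y => w y • y)
        rw [h3] at hc
        exact hc
      rw [hb, if_pos hv, ← this, hf]
      simp
  · exact ⟨0, by simp, fun x hx => by
      obtain ⟨w, _, _, hb⟩ := hw x hx
      rw [hb, if_neg hv]; simp⟩

theorem closure_eq_cells :
    closure Ω = ⋃ s : T.cells, convexHull ℝ (s.1 : Set (EuclideanSpace ℝ (Fin d))) := by
  rw [T.closure_eq]
  ext x
  rw [Geometry.SimplicialComplex.mem_space_iff, Set.mem_iUnion]
  constructor
  · rintro ⟨s, hs, hx⟩
    obtain ⟨t, ht, hst, hc⟩ := T.pure s hs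
    exact ⟨⟨t, ht, hc⟩, convexHull_mono (Finset.coe_subset.2 hst) hx⟩
  · rintro ⟨s, hx⟩
    exact ⟨s.1, s.2.1, hx⟩

/-- The nodal basis functions belong to `𝒫_k(T)`. -/
theorem nodalBasis_mem {k : ℕ} (a : T.Node k) : T.nodalBasis k a ∈ T.lagrangeSpace k := by
  classical
  have hpoly : ∀ s ∈ T.cells, ∃ q : MvPolynomial (Fin d) ℝ, q.totalDegree ≤ k ∧
      ∀ x ∈ convexHull ℝ (s : Set (EuclideanSpace ℝ (Fin d))),
        T.nodalBasis k a x = MvPolynomial.eval (fun i => x i) q := by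
    intro s hs
    choose q hq hqx using fun v => exists_affine hs v
    refine ⟨∏ v ∈ a.1.support, ∏ j ∈ Finset.range (a.1 v),
      MvPolynomial.C (((j : ℝ) + 1)⁻¹) *
        (MvPolynomial.C (k : ℝ) * q v + MvPolynomial.C (-(j : ℝ))), ?_, ?_⟩
    · refine (MvPolynomial.totalDegree_finsetProd _ _).trans ?_
      refine le_trans (Finset.sum_le_sum fun v _ => ?_) (le_of_eq a.2.2)
      refine (MvPolynomial.totalDegree_finsetProd _ _).trans ?_
      refine (Finset.sum_le_card_nsmul _ _ 1 fun j _ => ?_).trans (by simp)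
      refine (MvPolynomial.totalDegree_mul _ _).trans ?_
      rw [MvPolynomial.totalDegree_C, zero_add]
      refine (MvPolynomial.totalDegree_add _ _).trans (max_le ?_
        (by rw [MvPolynomial.totalDegree_C]; exact zero_le_one))
      refine (MvPolynomial.totalDegree_mul _ _).trans ?_
      rw [MvPolynomial.totalDegree_C, zero_add]
      exact hq v
    · intro x hx
      simp only [map_prod, map_mul, map_add, MvPolynomial.eval_C, ← hqx _ x hx]
      unfold nodalBasis
      refine Finset.prod_congr rfl fun v _ => Finset.prod_congr rfl fun j _ => ?_
      rw [div_eq_inv_mul, sub_eq_add_neg]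
  refine ⟨?_, ?_, hpoly⟩
  · have hfin : T.cells.Finite := T.finite_faces.subset fun s hs => hs.1
    have : Finite T.cells := hfin
    rw [T.closure_eq_cells]
    refine LocallyFinite.continuousOn_iUnion (locallyFinite_of_finite _) (fun s => ?_) fun s => ?_
    · exact (s.1.finite_toSet.isCompact_convexHull ℝ).isClosed
    · obtain ⟨q, _, hqx⟩ := hpoly s.1 s.2
      refine ContinuousOn.congr ?_ hqx
      refine Continuous.continuousOn ?_
      exact (MvPolynomial.continuous_eval q).comp (by fun_prop)
  · intro x hx
    have hb : T.bary x = 0 := by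
      rw [bary, dif_neg]
      rintro ⟨w, h0, hs, h1, hxw⟩
      apply hx
      rw [T.closure_eq, Geometry.SimplicialComplex.mem_space_iff]
      exact ⟨w.support, hs, Finset.mem_convexHull'.2 ⟨w, fun v _ => h0 v, h1, hxw⟩⟩
    obtain ⟨v, hv⟩ := T.nonempty_of_mem_faces a.2.1
    refine Finset.prod_eq_zero hv ?_
    refine Finset.prod_eq_zero (i := 0)
      (Finset.mem_range.2 (Nat.pos_of_ne_zero (Finsupp.mem_support_iff.1 hv))) ?_
    simp [hb]

end facts

/-- The mass matrix `M_u` of `𝒫_k(T)` in `L²(Ω)`. -/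
def massMatrix (k : ℕ) : Matrix (T.Node k) (T.Node k) ℝ :=
  Matrix.of fun a b => ∫ x in Ω, T.nodalBasis k a x * T.nodalBasis k b x

/-- The stiffness matrix `K_u` of `𝒫_k(T)` for the diffusion coefficient `α`. -/
def stiffnessMatrix (k : ℕ) (α : EuclideanSpace ℝ (Fin d) → ℝ) :
    Matrix (T.Node k) (T.Node k) ℝ :=
  Matrix.of fun a b => ∫ x in Ω, α x * inner ℝ (∇ (T.nodalBasis k a) x) (∇ (T.nodalBasis k b) x)

variable {T} in
/-- The boundary part `u_2` of a coefficient vector `u = (u_1, u_2)`. -/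
def boundaryPart {k : ℕ} (u : T.Node k → ℝ) : T.BoundaryNode k → ℝ := fun a => u a.1

variable {T} in
/-- The block `A_22` of a matrix `A` with respect to the decomposition `u = (u_1, u_2)`. -/
def boundaryBlock {k : ℕ} (A : Matrix (T.Node k) (T.Node k) ℝ) :
    Matrix (T.BoundaryNode k) (T.BoundaryNode k) ℝ :=
  A.submatrix (fun a => a.1) (fun a => a.1)

end Triangulation

/-- The surface measure on `Γ = ∂Ω`. -/
def surfaceMeasure {d : ℕ} (Ω : Set (EuclideanSpace ℝ (Fin d))) :
    Measure (EuclideanSpace ℝ (Fin d)) :=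
  (Measure.euclideanHausdorffMeasure (d - 1)).restrict (frontier Ω)

/-- The matrix of the `L²(Γ)` inner products of two families of functions. -/
def surfaceMatrix {d : ℕ} (Ω : Set (EuclideanSpace ℝ (Fin d))) {ι ι' : Type*}
    (f : ι → EuclideanSpace ℝ (Fin d) → ℝ) (g : ι' → EuclideanSpace ℝ (Fin d) → ℝ) :
    Matrix ι ι' ℝ :=
  Matrix.of fun i j => ∫ x, f i x * g j x ∂(surfaceMeasure Ω)

/-- Restriction of functions to `Γ = ∂Ω`. -/
def traceMap {d : ℕ} (Ω : Set (EuclideanSpace ℝ (Fin d))) :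
    (EuclideanSpace ℝ (Fin d) → ℝ) →ₗ[ℝ] (frontier Ω → ℝ) :=
  LinearMap.funLeft ℝ ℝ (Subtype.val : frontier Ω → EuclideanSpace ℝ (Fin d))

/-- The squared norm `‖x‖_M² = xᵀ M x` of a coefficient vector. -/
def normSq {ι : Type*} [Fintype ι] (M : Matrix ι ι ℝ) (x : ι → ℝ) : ℝ := x ⬝ᵥ M.mulVec x

end BulkSurface

end

/-! Write `d = m + 1`. Since the traces of `𝕍_h` are exactly `𝕄_h`, the trace of the bulk function
`u_h` is itself an admissible test function in `B_u u = B_p p`. Hence that trace is the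
`L²(Γ)`-projection of `p_h` onto the trace space, and `‖u_h‖_{L²(Γ)} ≤ ‖p‖_{M_p}`
(`integral_femFunction_sq_le`). What remains is a comparison of norms on the boundary nodal values,
with powers of `h` counted.

From below, `∑ u_a² ≤ C h^{-m} ‖u_h‖²_{L²(Γ)}` over the boundary nodes (`sum_sq_boundary_le`). Here
every boundary node must lie on a facet contained in `Γ` (`exists_facet_of_mem_frontier`). On such a
facet one passes to the reference simplex, where the Lagrange basis is linearly independent and
compactness gives the constant (`exists_sum_sq_le_integral_refShape`).

From above, `‖u_2‖²_{M_22} ≤ C h^{m+1} ∑ u_a²`, and the two gradients in `K_22` cost a further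
`h^{-2}`. Both are instances of `gram_quadratic_form_le`: few basis functions are nonzero at a
point, and each lives in a ball of radius `h`. Multiplication gives `h` and `h^{-1}`.

The inscribed ball is used only through `cellCoord_sub_le`: barycentric coordinates are Lipschitz
with constant `κ / h`. This bounds the gradients of the basis functions, and it bounds the surface
measure of a facet from below. -/

noncomputable section

namespace BulkSurface.Triangulation

variable {d : ℕ} {Ω : Set (EuclideanSpace ℝ (Fin d))} {T : Triangulation d Ω}

/-! ### Barycentric coordinates on one element -/

/-- The vertices of an element form an affine basis. -/
def cellBasis {s : Finset (EuclideanSpace ℝ (Fin d))} (hs : s ∈ T.cells) :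
    AffineBasis s ℝ (EuclideanSpace ℝ (Fin d)) :=
  ⟨(↑), T.indep hs.1, by
    rw [(T.indep hs.1).affineSpan_eq_top_iff_card_eq_finrank_add_one]
    simp [hs.2]⟩

open Classical in
/-- The barycentric coordinates with respect to an element, extended to the whole space as affine
functions, and zero for points that are not vertices of the element. -/
def cellCoord {s : Finset (EuclideanSpace ℝ (Fin d))} (hs : s ∈ T.cells)
    (v : EuclideanSpace ℝ (Fin d)) : EuclideanSpace ℝ (Fin d) →ᵃ[ℝ] ℝ :=
  if hv : v ∈ s then (cellBasis hs).coord ⟨v, hv⟩ else 0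

section
variable {s : Finset (EuclideanSpace ℝ (Fin d))} (hs : s ∈ T.cells)

theorem cellCoord_of_mem {v : EuclideanSpace ℝ (Fin d)} (hv : v ∈ s) :
    cellCoord hs v = (cellBasis hs).coord ⟨v, hv⟩ := dif_pos hv

theorem cellCoord_of_notMem {v : EuclideanSpace ℝ (Fin d)} (hv : v ∉ s)
    (x : EuclideanSpace ℝ (Fin d)) : cellCoord hs v x = 0 := by
  rw [cellCoord, dif_neg hv]; rfl

theorem sum_cellCoord (x : EuclideanSpace ℝ (Fin d)) : ∑ v ∈ s, cellCoord hs v x = 1 := by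
  rw [← Finset.sum_attach, ← (cellBasis hs).sum_coord_apply_eq_one x]
  exact Finset.sum_congr rfl fun v _ => by rw [cellCoord_of_mem hs v.2]

theorem range_cellBasis : Set.range (cellBasis hs) = (s : Set (EuclideanSpace ℝ (Fin d))) :=
  Subtype.range_coe

theorem mem_convexHull_iff_cellCoord {x : EuclideanSpace ℝ (Fin d)} :
    x ∈ convexHull ℝ (s : Set (EuclideanSpace ℝ (Fin d))) ↔ ∀ v ∈ s, 0 ≤ cellCoord hs v x := by
  rw [← range_cellBasis hs, (cellBasis hs).convexHull_eq_nonneg_coord]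
  constructor
  · intro h v hv
    rw [cellCoord_of_mem hs hv]
    exact h _
  · rintro h ⟨v, hv⟩
    rw [← cellCoord_of_mem hs hv]
    exact h v hv

theorem mem_interior_iff_cellCoord {x : EuclideanSpace ℝ (Fin d)} :
    x ∈ interior (convexHull ℝ (s : Set (EuclideanSpace ℝ (Fin d)))) ↔
      ∀ v ∈ s, 0 < cellCoord hs v x := by
  rw [← range_cellBasis hs, (cellBasis hs).interior_convexHull]
  constructor
  · intro h v hv
    rw [cellCoord_of_mem hs hv]
    exact h _
  · rintro h ⟨v, hv⟩
    rw [← cellCoord_of_mem hs hv]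
    exact h v hv

theorem interior_cell_nonempty {s : Finset (EuclideanSpace ℝ (Fin d))} (hs : s ∈ T.cells) :
    (interior (convexHull ℝ (s : Set (EuclideanSpace ℝ (Fin d))))).Nonempty := by
  rw [interior_convexHull_nonempty_iff_affineSpan_eq_top, ← range_cellBasis hs]
  exact (cellBasis hs).tot

open Classical in
theorem cellCoord_vertex {v w : EuclideanSpace ℝ (Fin d)} (hv : v ∈ s) (hw : w ∈ s) :
    cellCoord hs v w = if v = w then 1 else 0 := by
  rw [cellCoord_of_mem hs hv]
  refine ((cellBasis hs).coord_apply ⟨v, hv⟩ ⟨w, hw⟩).trans ?_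
  simp only [Subtype.mk.injEq]

theorem cellCoord_mem_Icc {x : EuclideanSpace ℝ (Fin d)}
    (hx : x ∈ convexHull ℝ (s : Set (EuclideanSpace ℝ (Fin d)))) (v : EuclideanSpace ℝ (Fin d)) :
    cellCoord hs v x ∈ Set.Icc (0 : ℝ) 1 := by
  rw [mem_convexHull_iff_cellCoord hs] at hx
  by_cases hv : v ∈ s
  · refine ⟨hx v hv, ?_⟩
    rw [← sum_cellCoord hs x]
    exact Finset.single_le_sum (f := fun v => cellCoord hs v x) hx hv
  · simp [cellCoord_of_notMem hs hv]

/-- An affine function with values in `[0, 1]` on a ball of radius `r` cannot change by more than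
`1` from the centre to the sphere, so its slope is at most `1 / r`. -/
theorem cellCoord_sub_le {c : EuclideanSpace ℝ (Fin d)} {r : ℝ} (hr : 0 < r)
    (hc : Metric.closedBall c r ⊆ convexHull ℝ (s : Set (EuclideanSpace ℝ (Fin d))))
    (v x y : EuclideanSpace ℝ (Fin d)) :
    |cellCoord hs v x - cellCoord hs v y| ≤ ‖x - y‖ / r := by
  set f := cellCoord hs v with hf
  have hsub : f x - f y = f.linear (x - y) := by
    have := f.linearMap_vsub x y
    simpa using this.symm
  rcases eq_or_ne x y with rfl | hxy
  · simp
  have hn : 0 < ‖x - y‖ := norm_pos_iff.2 (sub_ne_zero.2 hxy)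
  have h1 : f (c + (r / ‖x - y‖) • (x - y)) = f c + r / ‖x - y‖ * f.linear (x - y) := by
    have := f.map_vadd c ((r / ‖x - y‖) • (x - y))
    simp only [vadd_eq_add, map_smul, smul_eq_mul] at this
    rw [add_comm c, this, add_comm]
  have h2 := cellCoord_mem_Icc hs (hc (Metric.mem_closedBall_self hr.le)) v
  have h3 : f (c + (r / ‖x - y‖) • (x - y)) ∈ Set.Icc (0 : ℝ) 1 := by
    refine cellCoord_mem_Icc hs (hc ?_) v
    rw [mem_closedBall_iff_norm, add_sub_cancel_left, norm_smul, Real.norm_eq_abs,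
      abs_of_pos (by positivity), div_mul_cancel₀ _ hn.ne']
  rw [h1, ← hsub] at h3
  rw [← hf] at h2
  have h4 : |r / ‖x - y‖ * (f x - f y)| ≤ 1 := by
    rw [abs_le]; constructor <;> linarith [h2.1, h2.2, h3.1, h3.2]
  rw [abs_mul, abs_of_pos (by positivity), div_mul_eq_mul_div, div_le_one hn] at h4
  rw [le_div_iff₀ hr]
  linarith

end

theorem exists_isBary_of_mem_convexHull {t : Finset (EuclideanSpace ℝ (Fin d))} (ht : t ∈ T.faces)
    {x : EuclideanSpace ℝ (Fin d)} (hx : x ∈ convexHull ℝ (t : Set (EuclideanSpace ℝ (Fin d)))) :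
    ∃ w, T.IsBary x w ∧ w.support ⊆ t := by
  classical
  obtain ⟨w, h0, h1, hx⟩ := Finset.mem_convexHull'.1 hx
  let f : EuclideanSpace ℝ (Fin d) →₀ ℝ :=
    Finsupp.onFinset t (fun v => if v ∈ t then w v else 0) (by
      intro v hv; by_contra h; exact hv (if_neg h))
  have hfs : f.support ⊆ t := Finsupp.support_onFinset_subset
  have hf1 : (f.sum fun _ c => c) = 1 := by
    rw [Finsupp.sum_of_support_subset f hfs _ (by simp), ← h1]
    exact Finset.sum_congr rfl fun v hv => if_pos hv
  have hfx : (f.sum fun v c => c • v) = x := by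
    rw [Finsupp.sum_of_support_subset f hfs _ (by simp), ← hx]
    exact Finset.sum_congr rfl fun v hv => by
      change (if v ∈ t then w v else 0) • v = _
      rw [if_pos hv]
  have hne : f.support.Nonempty := by
    rw [Finset.nonempty_iff_ne_empty]
    intro h
    rw [Finsupp.support_eq_empty.1 h] at hf1
    simp at hf1
  refine ⟨f, ⟨fun v => ?_, T.down_closed ht hfs hne, hf1, hfx⟩, hfs⟩
  change 0 ≤ if v ∈ t then w v else 0
  split_ifs with h
  · exact h0 v h
  · exact le_rfl

theorem convexHull_face_subset {t : Finset (EuclideanSpace ℝ (Fin d))} (ht : t ∈ T.faces) :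
    convexHull ℝ (t : Set (EuclideanSpace ℝ (Fin d))) ⊆ closure Ω := by
  rw [T.closure_eq]
  exact Geometry.SimplicialComplex.convexHull_subset_space ht

theorem exists_cell_superset {t : Finset (EuclideanSpace ℝ (Fin d))} (ht : t ∈ T.faces) :
    ∃ s ∈ T.cells, t ⊆ s := by
  obtain ⟨s, hs, hts, hc⟩ := T.pure t ht
  exact ⟨s, ⟨hs, hc⟩, hts⟩

theorem isBary_bary {x : EuclideanSpace ℝ (Fin d)} (hx : x ∈ closure Ω) :
    T.IsBary x (T.bary x) := by
  rw [T.closure_eq, Geometry.SimplicialComplex.mem_space_iff] at hx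
  obtain ⟨s, hs, hx⟩ := hx
  obtain ⟨w, hw, -⟩ := exists_isBary_of_mem_convexHull hs hx
  rwa [hw.bary_eq]

theorem exists_cell_of_mem_closure (T : Triangulation d Ω) {x : EuclideanSpace ℝ (Fin d)}
    (hx : x ∈ closure Ω) :
    ∃ s ∈ T.cells, x ∈ convexHull ℝ (s : Set (EuclideanSpace ℝ (Fin d))) := by
  rw [closure_eq_cells (T := T), Set.mem_iUnion] at hx
  obtain ⟨s, hx⟩ := hx
  exact ⟨s, s.2, hx⟩

theorem IsBary.mem_convexHull {x : EuclideanSpace ℝ (Fin d)} {w : EuclideanSpace ℝ (Fin d) →₀ ℝ}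
    (hw : T.IsBary x w) {t : Finset (EuclideanSpace ℝ (Fin d))} (ht : w.support ⊆ t) :
    x ∈ convexHull ℝ (t : Set (EuclideanSpace ℝ (Fin d))) := by
  refine convexHull_mono (Finset.coe_subset.2 ht) ?_
  rw [Finset.mem_convexHull']
  exact ⟨w, fun v _ => hw.1 v, hw.2.2.1, hw.2.2.2⟩

/-- Uniqueness of barycentric coordinates makes membership in a simplex combinatorial: which
simplices contain a point is read off its support. -/
theorem mem_convexHull_iff_support {x : EuclideanSpace ℝ (Fin d)} (hx : x ∈ closure Ω)
    {t : Finset (EuclideanSpace ℝ (Fin d))} (ht : t ∈ T.faces) :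
    x ∈ convexHull ℝ (t : Set (EuclideanSpace ℝ (Fin d))) ↔ (T.bary x).support ⊆ t := by
  refine ⟨fun h => ?_, fun h => (isBary_bary hx).mem_convexHull h⟩
  obtain ⟨w, hw, hwt⟩ := exists_isBary_of_mem_convexHull ht h
  rwa [hw.bary_eq]

/-- This replaces the piecewise affine `T.bary` by one affine map of the whole space, which has a
linear part and can be followed across the boundary of the element. -/
theorem bary_eq_cellCoord {s : Finset (EuclideanSpace ℝ (Fin d))} (hs : s ∈ T.cells)
    {x : EuclideanSpace ℝ (Fin d)} (hx : x ∈ convexHull ℝ (s : Set (EuclideanSpace ℝ (Fin d))))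
    (v : EuclideanSpace ℝ (Fin d)) : T.bary x v = cellCoord hs v x := by
  obtain ⟨w, hw, hws⟩ := exists_isBary_of_mem_convexHull hs.1 hx
  rw [hw.bary_eq]
  by_cases hv : v ∈ s
  · obtain ⟨h0, hf, h1, hxw⟩ := hw
    rw [Finsupp.sum_of_support_subset w hws _ (by simp)] at h1 hxw
    have hc := (cellBasis hs).coord_apply_combination_of_mem (i := ⟨v, hv⟩) (s := Finset.univ)
      (Finset.mem_univ _) (w := fun y => w y)
      (by rw [Finset.univ_eq_attach, Finset.sum_attach s w, h1])
    have h3 : Finset.univ.affineCombination ℝ (cellBasis hs) (fun y : s => w y) = x := by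
      rw [Finset.affineCombination_eq_linear_combination _ _ _
        (by rw [Finset.univ_eq_attach, Finset.sum_attach s w, h1]), ← hxw,
        Finset.univ_eq_attach]
      exact Finset.sum_attach s (fun y => w y • y)
    rw [h3] at hc
    rw [cellCoord_of_mem hs hv, hc]
  · rw [cellCoord_of_notMem hs hv]
    exact Finsupp.notMem_support_iff.1 fun h => hv (hws h)

theorem isClosed_convexHull_face (s : Finset (EuclideanSpace ℝ (Fin d))) :
    IsClosed (convexHull ℝ (s : Set (EuclideanSpace ℝ (Fin d)))) :=
  (s.finite_toSet.isCompact_convexHull ℝ).isClosed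

theorem finite_cells (T : Triangulation d Ω) : T.cells.Finite :=
  T.finite_faces.subset fun _ hs => hs.1

theorem isCompact_closure (T : Triangulation d Ω) : IsCompact (closure Ω) := by
  have : Finite T.cells := T.finite_cells
  rw [closure_eq_cells (T := T)]
  exact isCompact_iUnion fun s => s.1.finite_toSet.isCompact_convexHull ℝ

theorem continuous_cellCoord {s : Finset (EuclideanSpace ℝ (Fin d))} (hs : s ∈ T.cells)
    (v : EuclideanSpace ℝ (Fin d)) : Continuous (cellCoord hs v) :=
  (cellCoord hs v).continuous_of_finiteDimensional

/-! ### The boundary as a union of facets -/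

open Filter Topology in
/-- Only the simplices containing a point meet a small neighbourhood of it. -/
theorem eventually_mem_convexHull (T : Triangulation d Ω) (x : EuclideanSpace ℝ (Fin d)) :
    ∀ᶠ y in 𝓝 x, ∀ s ∈ T.faces, y ∈ convexHull ℝ (s : Set (EuclideanSpace ℝ (Fin d))) →
      x ∈ convexHull ℝ (s : Set (EuclideanSpace ℝ (Fin d))) := by
  refine (eventually_all_finite T.finite_faces).2 fun s _ => ?_
  by_cases hx : x ∈ convexHull ℝ (s : Set (EuclideanSpace ℝ (Fin d)))
  · exact Eventually.of_forall fun _ _ => hx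
  · filter_upwards [(isClosed_convexHull_face s).isOpen_compl.mem_nhds hx] with y hy hy'
    exact absurd hy' hy

open Filter Topology in
/-- The relative interior of a simplex of the triangulation lies either in the interior or in the
boundary of the triangulated set. -/
theorem mem_interior_of_bary_support_eq {x y : EuclideanSpace ℝ (Fin d)}
    (hx : x ∈ closure Ω) (hy : y ∈ interior (closure Ω))
    (hxy : (T.bary x).support = (T.bary y).support) : x ∈ interior (closure Ω) := by
  have hyc := interior_subset hy
  have h1 : ∀ᶠ δ in 𝓝 (0 : EuclideanSpace ℝ (Fin d)), y + δ ∈ closure Ω := by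
    have : Tendsto (fun δ => y + δ) (𝓝 0) (𝓝 y) := by
      simpa using (continuous_const_add y).tendsto (0 : EuclideanSpace ℝ (Fin d))
    exact this.eventually (mem_interior_iff_mem_nhds.1 hy)
  have h2 : ∀ᶠ δ in 𝓝 (0 : EuclideanSpace ℝ (Fin d)), ∀ s ∈ T.faces,
      y + δ ∈ convexHull ℝ (s : Set (EuclideanSpace ℝ (Fin d))) →
      y ∈ convexHull ℝ (s : Set (EuclideanSpace ℝ (Fin d))) := by
    have : Tendsto (fun δ => y + δ) (𝓝 0) (𝓝 y) := by
      simpa using (continuous_const_add y).tendsto (0 : EuclideanSpace ℝ (Fin d))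
    exact this.eventually (T.eventually_mem_convexHull y)
  have h3 : ∀ᶠ δ in 𝓝 (0 : EuclideanSpace ℝ (Fin d)), ∀ s ∈ T.cells, ∀ hs : s ∈ T.cells,
      ∀ v ∈ s, 0 < cellCoord hs v x → 0 < cellCoord hs v (x + δ) := by
    refine (eventually_all_finite T.finite_cells).2 fun s hs => ?_
    simp only [hs, forall_true_left]
    refine (eventually_all_finset s).2 fun v _ => ?_
    by_cases h : 0 < cellCoord hs v x
    · have : Tendsto (fun δ => cellCoord hs v (x + δ)) (𝓝 0) (𝓝 (cellCoord hs v x)) := by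
        have h' : Continuous fun δ => cellCoord hs v (x + δ) :=
          (continuous_cellCoord hs v).comp (continuous_const_add x)
        simpa using h'.tendsto 0
      filter_upwards [this.eventually (lt_mem_nhds h)] with δ hδ _ using hδ
    · exact Eventually.of_forall fun _ h' => absurd h' h
  -- The element containing `y + δ` contains `y`, hence also `x`, which has the same support.
  -- Coordinates positive at `x` stay positive for small `δ`. Those vanishing at `x` vanish at `y`
  -- too, so at `x + δ` and `y + δ` they take the same value, their linear part at `δ`.
  have key : ∀ᶠ δ in 𝓝 (0 : EuclideanSpace ℝ (Fin d)), x + δ ∈ closure Ω := by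
    filter_upwards [h1, h2, h3] with δ h1 h2 h3
    obtain ⟨s, hs, hδ⟩ := T.exists_cell_of_mem_closure h1
    have hys := h2 s hs.1 hδ
    have hsy := (mem_convexHull_iff_support hyc hs.1).1 hys
    have hxs := (mem_convexHull_iff_support hx hs.1).2 (hxy ▸ hsy)
    refine convexHull_face_subset hs.1 ((mem_convexHull_iff_cellCoord hs).2 fun v hv => ?_)
    by_cases hvx : v ∈ (T.bary x).support
    · refine (h3 s hs hs v hv ?_).le
      rw [← bary_eq_cellCoord hs hxs]
      exact lt_of_le_of_ne ((isBary_bary hx).1 v) (Finsupp.mem_support_iff.1 hvx).symm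
    · have hx0 : cellCoord hs v x = 0 := by
        rw [← bary_eq_cellCoord hs hxs]; exact Finsupp.notMem_support_iff.1 hvx
      have hy0 : cellCoord hs v y = 0 := by
        rw [← bary_eq_cellCoord hs hys]; exact Finsupp.notMem_support_iff.1 (hxy ▸ hvx)
      have e1 := (cellCoord hs v).map_vadd x δ
      have e2 := (cellCoord hs v).map_vadd y δ
      simp only [vadd_eq_add, hx0, hy0, add_zero] at e1 e2
      rw [add_comm x, e1, ← e2, add_comm]
      exact (mem_convexHull_iff_cellCoord hs).1 hδ v hv
  rw [mem_interior_iff_mem_nhds]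
  have : Tendsto (fun z => z - x) (𝓝 x) (𝓝 0) := by
    simpa using (continuous_sub_right x).tendsto x
  filter_upwards [this.eventually key] with z hz
  simpa using hz

open Filter Topology in
/-- If a point of the relative interior of a simplex is a boundary point, then the whole simplex
lies in the boundary. -/
theorem convexHull_support_subset_frontier {x : EuclideanSpace ℝ (Fin d)} (hx : x ∈ closure Ω)
    (hxi : x ∉ interior (closure Ω)) :
    Disjoint (convexHull ℝ ((T.bary x).support : Set (EuclideanSpace ℝ (Fin d))))
      (interior (closure Ω)) := by
  rw [Set.disjoint_left]
  intro y hy hyi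
  refine hxi ?_
  have hb := isBary_bary (T := T) hx
  obtain ⟨w, hw, hwt⟩ := exists_isBary_of_mem_convexHull hb.2.1 hy
  -- A small move from `y` towards `x` stays in the open interior but acquires the full support of
  -- `x`, so the previous lemma applies to the moved point.
  have hlim : Tendsto (fun ε : ℝ => y + ε • (x - y)) (𝓝[>] 0) (𝓝 y) := by
    have : Continuous fun ε : ℝ => y + ε • (x - y) := by fun_prop
    simpa using (this.tendsto 0).mono_left nhdsWithin_le_nhds
  obtain ⟨ε, (hε : y + ε • (x - y) ∈ interior (closure Ω)), hε0, hε1⟩ :=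
    ((hlim.eventually (isOpen_interior.mem_nhds hyi)).and
    (Ioo_mem_nhdsGT (zero_lt_one' ℝ))).exists
  refine mem_interior_of_bary_support_eq (T := T) hx hε ?_
  have hsupp : ((1 - ε) • w + ε • T.bary x).support = (T.bary x).support := by
    ext v
    have h0 := hw.1 v
    have h1 := hb.1 v
    have hmem : v ∉ (T.bary x).support → w v = 0 := fun h =>
      Finsupp.notMem_support_iff.1 fun h' => h (hwt h')
    by_cases hv : v ∈ (T.bary x).support
    · have : 0 < T.bary x v := lt_of_le_of_ne h1 (Finsupp.mem_support_iff.1 hv).symm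
      simp only [hv, iff_true, Finsupp.mem_support_iff, Finsupp.add_apply, Finsupp.smul_apply,
        smul_eq_mul]
      have : 0 < ε * T.bary x v := by positivity
      have : 0 ≤ (1 - ε) * w v := mul_nonneg (by linarith) h0
      linarith
    · have hv' := Finsupp.notMem_support_iff.1 hv
      simp [hmem hv, hv']
  have : T.IsBary (y + ε • (x - y)) ((1 - ε) • w + ε • T.bary x) := by
    refine ⟨fun v => ?_, by rw [hsupp]; exact hb.2.1, ?_, ?_⟩
    · simp only [Finsupp.add_apply, Finsupp.smul_apply, smul_eq_mul]
      have := mul_nonneg (sub_nonneg.2 hε1.le) (hw.1 v)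
      have := mul_nonneg hε0.le (hb.1 v)
      linarith
    · rw [Finsupp.sum_add_index' (by simp) (by simp), Finsupp.sum_smul_index' (by simp),
        Finsupp.sum_smul_index' (by simp)]
      simp only [smul_eq_mul]
      rw [← Finsupp.mul_sum, ← Finsupp.mul_sum, hw.2.2.1, hb.2.2.1]
      ring
    · rw [Finsupp.sum_add_index' (by simp) (by simp [add_smul]),
        Finsupp.sum_smul_index' (by simp), Finsupp.sum_smul_index' (by simp)]
      simp only [smul_assoc]
      rw [← Finsupp.smul_sum, ← Finsupp.smul_sum, hw.2.2.2, hb.2.2.2]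
      module
  rw [this.bary_eq, hsupp]

theorem card_face_le {t : Finset (EuclideanSpace ℝ (Fin d))} (ht : t ∈ T.faces) :
    t.card ≤ d + 1 := by
  obtain ⟨s, hs, hts⟩ := exists_cell_superset ht
  exact hs.2 ▸ Finset.card_le_card hts

/-- At most `d` points span dimension at most `d - 1`. Thus the cone with apex `y` over a simplex of
codimension at least two is a null set, and a generic segment from `y` avoids that simplex. -/
theorem affineSpan_insert_ne_top {t : Finset (EuclideanSpace ℝ (Fin d))} (ht : t.card < d)
    (y : EuclideanSpace ℝ (Fin d)) :
    affineSpan ℝ (insert y (t : Set (EuclideanSpace ℝ (Fin d)))) ≠ ⊤ := by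
  classical
  intro h
  have h1 := congrArg AffineSubspace.direction h
  rw [direction_affineSpan, AffineSubspace.direction_top, ← Finset.coe_insert] at h1
  have h2 := finrank_vectorSpan_image_finset_le ℝ (id : EuclideanSpace ℝ (Fin d) → _) (insert y t)
    (n := (insert y t).card - 1)
    (Nat.sub_add_cancel (Finset.card_pos.2 (Finset.insert_nonempty _ _))).symm
  rw [Finset.image_id, h1, finrank_top, finrank_euclideanSpace_fin] at h2
  have := Finset.card_insert_le y t
  omega

open Filter Topology in
/-- The boundary is the union of the facets that it contains. -/
theorem exists_facet_of_mem_frontier (hΩ : interior (closure Ω) = Ω)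
    {x : EuclideanSpace ℝ (Fin d)} (hx : x ∈ frontier Ω) :
    ∃ t ∈ T.faces, t.card = d ∧ x ∈ convexHull ℝ (t : Set (EuclideanSpace ℝ (Fin d))) ∧
      convexHull ℝ (t : Set (EuclideanSpace ℝ (Fin d))) ⊆ frontier Ω := by
  have hopen : IsOpen Ω := hΩ ▸ isOpen_interior
  have hfr : frontier Ω = closure Ω \ interior (closure Ω) := by
    rw [hΩ, hopen.frontier_eq]
  rw [hfr] at hx ⊢
  -- Every simplex meeting this ball contains `x`, so it suffices to find a boundary facet that
  -- meets the ball.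
  obtain ⟨ε, hε, hball⟩ := Metric.eventually_nhds_iff_ball.1 (T.eventually_mem_convexHull x)
  obtain ⟨y, hyB, hy⟩ : ∃ y ∈ Metric.ball x ε, y ∉ closure Ω := by
    by_contra! h
    exact hx.2 (mem_interior_iff_mem_nhds.2 (Filter.mem_of_superset (Metric.ball_mem_nhds x hε) h))
  obtain ⟨s, hs, hxs⟩ := T.exists_cell_of_mem_closure hx.1
  have hconv : Convex ℝ (convexHull ℝ (s : Set (EuclideanSpace ℝ (Fin d)))) := convex_convexHull _ _
  have hxs' : x ∈ closure (interior (convexHull ℝ (s : Set (EuclideanSpace ℝ (Fin d))))) := by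
    rw [hconv.closure_interior_eq_closure_of_nonempty_interior (interior_cell_nonempty hs)]
    exact subset_closure hxs
  -- A generic `z` in a nonempty open set: off the finitely many null cones with apex `y` over
  -- simplices of codimension at least two.
  obtain ⟨z, ⟨hzB, hzs⟩, hz⟩ : ∃ z ∈ Metric.ball x ε ∩
      interior (convexHull ℝ (s : Set (EuclideanSpace ℝ (Fin d)))),
      ∀ t ∈ T.faces, t.card < d →
        z ∉ affineSpan ℝ (insert y (t : Set (EuclideanSpace ℝ (Fin d)))) := by
    have hO : IsOpen (Metric.ball x ε ∩
      interior (convexHull ℝ (s : Set (EuclideanSpace ℝ (Fin d))))) :=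
      Metric.isOpen_ball.inter isOpen_interior
    have hne := mem_closure_iff.1 hxs' _ Metric.isOpen_ball (Metric.mem_ball_self hε)
    have hae : ∀ᵐ z : EuclideanSpace ℝ (Fin d), ∀ t ∈ T.faces, t.card < d →
        z ∉ affineSpan ℝ (insert y (t : Set (EuclideanSpace ℝ (Fin d)))) := by
      rw [MeasureTheory.ae_ball_iff T.finite_faces.countable]
      intro t _
      by_cases htd : t.card < d
      · have := Measure.addHaar_affineSubspace (volume : Measure (EuclideanSpace ℝ (Fin d)))
          _ (affineSpan_insert_ne_top htd y)
        filter_upwards [measure_eq_zero_iff_ae_notMem.1 this] with z hz _ using hz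
      · exact Eventually.of_forall fun _ h => absurd h htd
    by_contra! hcon
    have h0 : volume (Metric.ball x ε ∩
      interior (convexHull ℝ (s : Set (EuclideanSpace ℝ (Fin d))))) = 0 := by
      rw [measure_eq_zero_iff_ae_notMem]
      filter_upwards [hae] with z hz hmem
      obtain ⟨t, ht, htd, h⟩ := hcon z hmem
      exact hz t ht htd h
    exact (hO.measure_pos volume hne).ne' h0
  have hzP : z ∈ closure Ω := convexHull_face_subset hs.1 (interior_subset hzs)
  -- The segment runs from `y` outside to `z` inside. Its first point `f τ` in `closure Ω` is not
  -- interior, since otherwise earlier points would also belong.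
  set f : ℝ → EuclideanSpace ℝ (Fin d) := fun τ => AffineMap.lineMap y z τ with hf
  have hfc : Continuous f := AffineMap.lineMap_continuous
  have hK : IsCompact (Set.Icc (0 : ℝ) 1 ∩ f ⁻¹' closure Ω) :=
    isCompact_Icc.inter_right (isClosed_closure.preimage hfc)
  obtain ⟨τ, ⟨hτ, hτP⟩, hmin⟩ := hK.exists_isLeast ⟨1, by simp, by simpa [hf] using hzP⟩
  have hτ0 : 0 < τ := by
    refine lt_of_le_of_ne hτ.1 fun h => hy ?_
    rw [← h] at hτP
    simpa [hf] using hτP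
  have hwi : f τ ∉ interior (closure Ω) := by
    intro hi
    have : Tendsto f (𝓝[<] τ) (𝓝 (f τ)) := (hfc.tendsto τ).mono_left nhdsWithin_le_nhds
    obtain ⟨σ, (hσ : f σ ∈ interior (closure Ω)), hσ0, hστ⟩ :=
      ((this.eventually (isOpen_interior.mem_nhds hi)).and
      (Ioo_mem_nhdsLT hτ0)).exists
    exact absurd (hmin ⟨⟨hσ0.le, hστ.le.trans hτ.2⟩, show f σ ∈ closure Ω from interior_subset hσ⟩)
      (not_le.2 hστ)
  have hwB : f τ ∈ Metric.ball x ε :=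
    (convex_ball x ε).lineMap_mem hyB hzB hτ
  have hb := isBary_bary (T := T) hτP
  have hdis := convexHull_support_subset_frontier (T := T) hτP hwi
  have hwt := hb.mem_convexHull (Finset.Subset.refl _)
  refine ⟨(T.bary (f τ)).support, hb.2.1, ?_, hball _ hwB _ hb.2.1 hwt, fun v hv =>
    ⟨convexHull_face_subset hb.2.1 hv, Set.disjoint_left.1 hdis hv⟩⟩
  -- The simplex carrying `f τ` has exactly `d` vertices: fewer would put `z`, on the line through
  -- `y` and `f τ`, into an excluded cone, and `d + 1` would put `f τ` in the interior of an
  -- element.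
  rcases lt_trichotomy (T.bary (f τ)).support.card d with hlt | heq | hgt
  · exfalso
    refine hz _ hb.2.1 hlt ?_
    have h1 : f τ ∈ affineSpan ℝ (insert y
        ((T.bary (f τ)).support : Set (EuclideanSpace ℝ (Fin d)))) :=
      affineSpan_mono ℝ (Set.subset_insert _ _) (convexHull_subset_affineSpan _ hwt)
    have h2 := AffineMap.lineMap_mem τ⁻¹ (subset_affineSpan ℝ _ (Set.mem_insert _ _)) h1
    have h3 : AffineMap.lineMap y (f τ) τ⁻¹ = z := by
      simp only [hf, AffineMap.lineMap_apply, vsub_eq_sub, vadd_eq_add, add_sub_cancel_right,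
        smul_smul, inv_mul_cancel₀ hτ0.ne', one_smul, sub_add_cancel]
    rwa [h3] at h2
  · exact heq
  · exfalso
    have hcell : (T.bary (f τ)).support ∈ T.cells :=
      ⟨hb.2.1, le_antisymm (card_face_le hb.2.1) hgt⟩
    refine hwi (interior_mono (convexHull_face_subset hb.2.1)
      ((mem_interior_iff_cellCoord hcell).2 fun v hv => ?_))
    rw [← bary_eq_cellCoord hcell hwt]
    exact lt_of_le_of_ne (hb.1 v) (Finsupp.mem_support_iff.1 hv).symm

end BulkSurface.Triangulation

/-! ### Size, slope and support of the Lagrange basis functions -/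

namespace BulkSurface

/-- Factors are exchanged one at a time. Since `1 ≤ M`, the exponents may be padded to the full
cardinality, which keeps the bound in closed form. -/
theorem abs_prod_sub_prod_le {ι : Type*} (s : Finset ι) {f g : ι → ℝ} {M L : ℝ} (hM : 1 ≤ M)
    (hL : 0 ≤ L) (hf : ∀ i ∈ s, |f i| ≤ M) (hg : ∀ i ∈ s, |g i| ≤ M)
    (hfg : ∀ i ∈ s, |f i - g i| ≤ L) :
    |∏ i ∈ s, f i - ∏ i ∈ s, g i| ≤ s.card * M ^ s.card * L := by
  classical
  induction s using Finset.induction_on with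
  | empty => simp
  | insert i s hi ih =>
    rw [Finset.prod_insert hi, Finset.prod_insert hi, Finset.card_insert_of_notMem hi]
    have h1 := ih (fun j hj => hf j (Finset.mem_insert_of_mem hj))
      (fun j hj => hg j (Finset.mem_insert_of_mem hj))
      (fun j hj => hfg j (Finset.mem_insert_of_mem hj))
    have h2 : |∏ j ∈ s, g j| ≤ M ^ s.card := by
      rw [Finset.abs_prod, ← Finset.prod_const]
      exact Finset.prod_le_prod (fun _ _ => abs_nonneg _)
        fun j hj => hg j (Finset.mem_insert_of_mem hj)
    have hpow : M ^ s.card ≤ M ^ (s.card + 1) := pow_le_pow_right₀ hM (Nat.le_succ _)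
    calc |f i * ∏ j ∈ s, f j - g i * ∏ j ∈ s, g j|
        = |f i * (∏ j ∈ s, f j - ∏ j ∈ s, g j) + (f i - g i) * ∏ j ∈ s, g j| := by
          congr 1; ring
      _ ≤ |f i| * |∏ j ∈ s, f j - ∏ j ∈ s, g j| + |f i - g i| * |∏ j ∈ s, g j| := by
          rw [← abs_mul, ← abs_mul]; exact abs_add_le _ _
      _ ≤ M * (s.card * M ^ s.card * L) + L * M ^ s.card := by
          refine add_le_add (mul_le_mul (hf i (Finset.mem_insert_self _ _)) h1 (abs_nonneg _)
            (by linarith)) (mul_le_mul (hfg i (Finset.mem_insert_self _ _)) h2 (abs_nonneg _) hL)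
      _ ≤ M * (s.card * M ^ s.card * L) + L * M ^ (s.card + 1) := by gcongr
      _ = ((s.card + 1 : ℕ) : ℝ) * M ^ (s.card + 1) * L := by push_cast; ring

/-- The one-dimensional factors of the Lagrange basis functions. -/
def nodalFactor (k m : ℕ) (t : ℝ) : ℝ := ∏ j ∈ Finset.range m, ((k : ℝ) * t - j) / (j + 1)

theorem continuous_nodalFactor (k m : ℕ) : Continuous (nodalFactor k m) := by
  unfold nodalFactor
  fun_prop

theorem nodalFactor_zero_right {k m : ℕ} (hm : m ≠ 0) : nodalFactor k m 0 = 0 :=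
  Finset.prod_eq_zero (i := 0) (Finset.mem_range.2 (Nat.pos_of_ne_zero hm)) (by simp)

theorem abs_nodalFactor_term_le {k m j : ℕ} (hm : m ≤ k) {t : ℝ} (ht : t ∈ Set.Icc (0 : ℝ) 1)
    (hj : j ∈ Finset.range m) : |((k : ℝ) * t - j) / (j + 1)| ≤ k := by
  have hjk : (j : ℝ) ≤ k := by exact_mod_cast (Finset.mem_range.1 hj).le.trans hm
  have h1 : (0 : ℝ) ≤ k * t := mul_nonneg (Nat.cast_nonneg _) ht.1
  have h2 : (k : ℝ) * t ≤ k := mul_le_of_le_one_right (Nat.cast_nonneg _) ht.2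
  rw [abs_div, abs_of_pos (by positivity : (0 : ℝ) < j + 1)]
  refine (div_le_self (abs_nonneg _) (by simp)).trans ?_
  rw [abs_le]
  constructor <;> linarith [(Nat.cast_nonneg j : (0 : ℝ) ≤ j)]

theorem abs_nodalFactor_le {k m : ℕ} (hk : 1 ≤ k) (hm : m ≤ k) {t : ℝ}
    (ht : t ∈ Set.Icc (0 : ℝ) 1) : |nodalFactor k m t| ≤ (k : ℝ) ^ k := by
  have hk' : (1 : ℝ) ≤ k := by exact_mod_cast hk
  rw [nodalFactor, Finset.abs_prod]
  refine (Finset.prod_le_prod (fun _ _ => abs_nonneg _)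
    fun j hj => abs_nodalFactor_term_le hm ht hj).trans ?_
  rw [Finset.prod_const, Finset.card_range]
  exact pow_le_pow_right₀ hk' hm

theorem abs_nodalFactor_sub_le {k m : ℕ} (hk : 1 ≤ k) (hm : m ≤ k) {t t' : ℝ}
    (ht : t ∈ Set.Icc (0 : ℝ) 1) (ht' : t' ∈ Set.Icc (0 : ℝ) 1) :
    |nodalFactor k m t - nodalFactor k m t'| ≤ k * (k : ℝ) ^ k * (k * |t - t'|) := by
  have hk' : (1 : ℝ) ≤ k := by exact_mod_cast hk
  have h := abs_prod_sub_prod_le (Finset.range m) (L := k * |t - t'|) hk' (by positivity)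
    (fun j hj => abs_nodalFactor_term_le hm ht hj) (fun j hj => abs_nodalFactor_term_le hm ht' hj)
    (fun j _ => by
      rw [← sub_div, abs_div, abs_of_pos (by positivity : (0 : ℝ) < j + 1)]
      refine (div_le_self (abs_nonneg _) (by simp)).trans (le_of_eq ?_)
      rw [sub_sub_sub_cancel_right, ← mul_sub, abs_mul, abs_of_nonneg (by linarith)])
  refine h.trans ?_
  rw [Finset.card_range]
  have : (m : ℝ) ≤ k := by exact_mod_cast hm
  have : (k : ℝ) ^ m ≤ (k : ℝ) ^ k := pow_le_pow_right₀ hk' hm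
  gcongr

/-- A uniform bound for the Lagrange basis functions of degree `k`. -/
def nodalBound (k : ℕ) : ℝ := ((k : ℝ) ^ k) ^ k

/-- A uniform bound for the derivatives of the Lagrange basis functions of degree `k` with respect
to the barycentric coordinates. -/
def nodalLipBound (k : ℕ) : ℝ := k * ((k : ℝ) ^ k) ^ k * (k * (k : ℝ) ^ k * k)

namespace Triangulation

variable {d : ℕ} {Ω : Set (EuclideanSpace ℝ (Fin d))} {T : Triangulation d Ω} {k : ℕ}

theorem nodalBasis_eq (a : T.Node k) (x : EuclideanSpace ℝ (Fin d)) :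
    T.nodalBasis k a x = ∏ v ∈ a.1.support, nodalFactor k (a.1 v) (T.bary x v) := rfl

theorem Node.apply_le (a : T.Node k) (v : EuclideanSpace ℝ (Fin d)) : a.1 v ≤ k := by
  by_cases hv : v ∈ a.1.support
  · conv_rhs => rw [← a.2.2]
    exact Finset.single_le_sum (f := fun v => a.1 v) (fun _ _ => Nat.zero_le _) hv
  · rw [Finsupp.notMem_support_iff.1 hv]; exact Nat.zero_le _

theorem Node.card_support_le (a : T.Node k) : a.1.support.card ≤ k := by
  conv_rhs => rw [← a.2.2]
  rw [Finset.card_eq_sum_ones]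
  exact Finset.sum_le_sum fun v hv => Nat.one_le_iff_ne_zero.2 (Finsupp.mem_support_iff.1 hv)

theorem Node.point_mem_convexHull (hk : 1 ≤ k) (a : T.Node k)
    {t : Finset (EuclideanSpace ℝ (Fin d))} (ht : a.1.support ⊆ t) :
    a.point ∈ convexHull ℝ (t : Set (EuclideanSpace ℝ (Fin d))) :=
  (a.isBary hk).mem_convexHull (Finsupp.support_mapRange.trans ht)

theorem Node.support_subset (hk : 1 ≤ k) (a : T.Node k)
    {t : Finset (EuclideanSpace ℝ (Fin d))} (ht : t ∈ T.faces)
    (h : a.point ∈ convexHull ℝ (t : Set (EuclideanSpace ℝ (Fin d)))) : a.1.support ⊆ t := by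
  have hk' : (k : ℝ) ≠ 0 := by positivity
  have h1 := (mem_convexHull_iff_support (convexHull_face_subset ht h) ht).1 h
  rw [(a.isBary hk).bary_eq] at h1
  intro v hv
  refine h1 ?_
  simpa [hk'] using hv

/-- Each factor with positive index contains the term `j = 0`, a multiple of the coordinate itself,
so it vanishes where that coordinate does. All locality of the basis comes from here. -/
theorem support_subset_of_nodalBasis_ne_zero {a : T.Node k} {x : EuclideanSpace ℝ (Fin d)}
    (h : T.nodalBasis k a x ≠ 0) : a.1.support ⊆ (T.bary x).support := by
  intro v hv
  rw [nodalBasis_eq, Finset.prod_ne_zero_iff] at h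
  rw [Finsupp.mem_support_iff]
  intro h0
  refine h v hv ?_
  rw [h0]
  exact nodalFactor_zero_right (Finsupp.mem_support_iff.1 hv)

theorem bary_mem_Icc (x v : EuclideanSpace ℝ (Fin d)) : T.bary x v ∈ Set.Icc (0 : ℝ) 1 := by
  by_cases h : ∃ w, T.IsBary x w
  · obtain ⟨w, h0, hs, h1, hx⟩ := h
    rw [IsBary.bary_eq ⟨h0, hs, h1, hx⟩]
    refine ⟨h0 v, ?_⟩
    by_cases hv : v ∈ w.support
    · rw [← h1]
      exact Finset.single_le_sum (f := fun v => w v) (fun v _ => h0 v) hv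
    · rw [Finsupp.notMem_support_iff.1 hv]; exact zero_le_one
  · rw [bary, dif_neg h]; simp

theorem abs_nodalBasis_le (hk : 1 ≤ k) (a : T.Node k) (x : EuclideanSpace ℝ (Fin d)) :
    |T.nodalBasis k a x| ≤ nodalBound k := by
  have hk' : (1 : ℝ) ≤ k := by exact_mod_cast hk
  rw [nodalBasis_eq, Finset.abs_prod]
  refine (Finset.prod_le_prod (fun _ _ => abs_nonneg _)
    fun v _ => abs_nodalFactor_le hk (a.apply_le v) (bary_mem_Icc x v)).trans ?_
  rw [Finset.prod_const]
  exact pow_le_pow_right₀ (one_le_pow₀ hk') a.card_support_le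

/-- The product has at most `k` factors, because the positive entries of a multi-index sum to `k`;
the constant is therefore independent of the dimension. -/
theorem abs_nodalBasis_sub_le (hk : 1 ≤ k) (a : T.Node k)
    {s : Finset (EuclideanSpace ℝ (Fin d))} (hs : s ∈ T.cells)
    {c : EuclideanSpace ℝ (Fin d)} {r : ℝ} (hr : 0 < r)
    (hc : Metric.closedBall c r ⊆ convexHull ℝ (s : Set (EuclideanSpace ℝ (Fin d))))
    {x y : EuclideanSpace ℝ (Fin d)}
    (hx : x ∈ convexHull ℝ (s : Set (EuclideanSpace ℝ (Fin d))))
    (hy : y ∈ convexHull ℝ (s : Set (EuclideanSpace ℝ (Fin d)))) :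
    |T.nodalBasis k a x - T.nodalBasis k a y| ≤ nodalLipBound k / r * ‖x - y‖ := by
  have hk' : (1 : ℝ) ≤ k := by exact_mod_cast hk
  have hM : (1 : ℝ) ≤ (k : ℝ) ^ k := one_le_pow₀ hk'
  rw [nodalBasis_eq, nodalBasis_eq]
  have h := abs_prod_sub_prod_le a.1.support (L := k * (k : ℝ) ^ k * (k * (‖x - y‖ / r))) hM
    (by positivity)
    (fun v _ => abs_nodalFactor_le hk (a.apply_le v) (bary_mem_Icc x v))
    (fun v _ => abs_nodalFactor_le hk (a.apply_le v) (bary_mem_Icc y v))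
    (fun v _ => by
      refine (abs_nodalFactor_sub_le hk (a.apply_le v) (bary_mem_Icc x v)
        (bary_mem_Icc y v)).trans ?_
      have := cellCoord_sub_le hs hr hc v x y
      rw [← bary_eq_cellCoord hs hx, ← bary_eq_cellCoord hs hy] at this
      gcongr)
  refine h.trans ?_
  have h1 : (a.1.support.card : ℝ) ≤ k := by exact_mod_cast a.card_support_le
  have h2 : ((k : ℝ) ^ k) ^ a.1.support.card ≤ ((k : ℝ) ^ k) ^ k :=
    pow_le_pow_right₀ hM a.card_support_le
  calc _ ≤ k * ((k : ℝ) ^ k) ^ k * (k * (k : ℝ) ^ k * (k * (‖x - y‖ / r))) := by gcongr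
    _ = nodalLipBound k / r * ‖x - y‖ := by unfold nodalLipBound; ring

theorem norm_gradient_nodalBasis_le (hk : 1 ≤ k) (a : T.Node k)
    {s : Finset (EuclideanSpace ℝ (Fin d))} (hs : s ∈ T.cells)
    {c : EuclideanSpace ℝ (Fin d)} {r : ℝ} (hr : 0 < r)
    (hc : Metric.closedBall c r ⊆ convexHull ℝ (s : Set (EuclideanSpace ℝ (Fin d))))
    {x : EuclideanSpace ℝ (Fin d)}
    (hx : x ∈ interior (convexHull ℝ (s : Set (EuclideanSpace ℝ (Fin d))))) :
    ‖∇ (T.nodalBasis k a) x‖ ≤ nodalLipBound k / r := by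
  have hC : 0 ≤ nodalLipBound k / r := by unfold nodalLipBound; positivity
  have hL : LipschitzOnWith ⟨nodalLipBound k / r, hC⟩ (T.nodalBasis k a)
      (convexHull ℝ (s : Set (EuclideanSpace ℝ (Fin d)))) := by
    refine LipschitzOnWith.of_dist_le_mul fun y hy z hz => ?_
    rw [Real.dist_eq, dist_eq_norm]
    exact abs_nodalBasis_sub_le hk a hs hr hc hy hz
  -- Differentiability need not be checked: the derivative is zero by convention where it does not
  -- exist.
  have := norm_fderiv_le_of_lipschitzOn ℝ (mem_interior_iff_mem_nhds.1 hx) hL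
  rw [gradient, LinearIsometryEquiv.norm_map]
  exact this

theorem gradient_nodalBasis_eq_zero (a : T.Node k)
    {s : Finset (EuclideanSpace ℝ (Fin d))} (hs : s ∈ T.cells) (ha : ¬ a.1.support ⊆ s)
    {x : EuclideanSpace ℝ (Fin d)}
    (hx : x ∈ interior (convexHull ℝ (s : Set (EuclideanSpace ℝ (Fin d))))) :
    ∇ (T.nodalBasis k a) x = 0 := by
  have : T.nodalBasis k a =ᶠ[nhds x] fun _ => 0 := by
    filter_upwards [mem_interior_iff_mem_nhds.1 hx] with y hy
    by_contra h
    exact ha ((support_subset_of_nodalBasis_ne_zero h).trans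
      ((mem_convexHull_iff_support (convexHull_face_subset hs.1 hy) hs.1).1 hy))
  rw [gradient, this.fderiv_eq]
  simp

/-- A node supported on `s` is determined by its entries in `{0, …, k}` on `s`. This crude count
bounds the overlap of the basis functions independently of the mesh. -/
theorem card_boundaryNode_le {s : Finset (EuclideanSpace ℝ (Fin d))}
    (S : Finset (T.BoundaryNode k)) (hS : ∀ a ∈ S, a.1.1.support ⊆ s) :
    S.card ≤ (k + 1) ^ s.card := by
  classical
  have : Fintype.card S ≤ Fintype.card (s → Fin (k + 1)) := by
    refine Fintype.card_le_of_injective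
      (fun a v => ⟨a.1.1.1 v, Nat.lt_succ_of_le (a.1.1.apply_le v)⟩) fun a b hab => ?_
    refine Subtype.ext (Subtype.ext (Subtype.ext (Finsupp.ext fun v => ?_)))
    by_cases hv : v ∈ s
    · have := congrFun hab ⟨v, hv⟩
      simpa using this
    · rw [Finsupp.notMem_support_iff.1 fun h => hv (hS a.1 a.2 h),
        Finsupp.notMem_support_iff.1 fun h => hv (hS b.1 b.2 h)]
  simpa using this

theorem dist_le_meshWidth {s : Finset (EuclideanSpace ℝ (Fin d))} (hs : s ∈ T.cells)
    {x y : EuclideanSpace ℝ (Fin d)}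
    (hx : x ∈ convexHull ℝ (s : Set (EuclideanSpace ℝ (Fin d))))
    (hy : y ∈ convexHull ℝ (s : Set (EuclideanSpace ℝ (Fin d)))) :
    dist x y ≤ T.meshWidth :=
  (Metric.dist_le_diam_of_mem (s.finite_toSet.isCompact_convexHull ℝ).isBounded hx hy).trans
    (le_csSup (T.finite_cells.image _).bddAbove (Set.mem_image_of_mem _ hs))

theorem meshWidth_pos (hd : d ≠ 0) {s : Finset (EuclideanSpace ℝ (Fin d))} (hs : s ∈ T.cells) :
    0 < T.meshWidth := by
  obtain ⟨x, hx, y, hy, hxy⟩ := Finset.one_lt_card.1 (show 1 < s.card by rw [hs.2]; omega)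
  exact (dist_pos.2 hxy).trans_le (dist_le_meshWidth hs (subset_convexHull ℝ _ hx)
    (subset_convexHull ℝ _ hy))

/-- Frontiers of convex sets are null. Integrals over `Ω` therefore see only the interiors of
elements, where the gradient bounds hold. -/
theorem ae_mem_interior_cell (T : Triangulation d Ω) :
    ∀ᵐ x ∂(volume.restrict Ω), ∃ s ∈ T.cells,
      x ∈ interior (convexHull ℝ (s : Set (EuclideanSpace ℝ (Fin d)))) := by
  have h : ∀ᵐ x : EuclideanSpace ℝ (Fin d), ∀ s ∈ T.cells,
      x ∉ frontier (convexHull ℝ (s : Set (EuclideanSpace ℝ (Fin d)))) := by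
    rw [ae_ball_iff T.finite_cells.countable]
    exact fun s _ => measure_eq_zero_iff_ae_notMem.1
      ((convex_convexHull ℝ (s : Set (EuclideanSpace ℝ (Fin d)))).addHaar_frontier volume)
  have hcl : ∀ᵐ x ∂(volume.restrict Ω), x ∈ closure Ω :=
    ae_restrict_of_ae_restrict_of_subset subset_closure
      (ae_restrict_mem isClosed_closure.measurableSet)
  filter_upwards [ae_restrict_of_ae h, hcl] with x hx hxc
  obtain ⟨s, hs, hxs⟩ := T.exists_cell_of_mem_closure hxc
  refine ⟨s, hs, ?_⟩
  by_contra hi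
  exact hx s hs ⟨subset_closure hxs, hi⟩

end Triangulation

/-! ### Quadratic forms of Gram matrices -/

/-- An upper bound for the quadratic form of a Gram matrix of functions with small supports and
bounded overlap. -/
theorem gram_quadratic_form_le {X F ι : Type*} [MeasurableSpace X]
    [NormedAddCommGroup F] [InnerProductSpace ℝ F] [Fintype ι]
    (ν : Measure X) [IsFiniteMeasure ν] {w : X → ℝ} {f : ι → X → F} {S : ι → Set X}
    {A D V : ℝ} {N : ℕ} (hA : 0 ≤ A)
    (hw : AEStronglyMeasurable w ν) (hf : ∀ a, AEStronglyMeasurable (f a) ν)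
    (hS : ∀ a, MeasurableSet (S a)) (hV : ∀ a, ν.real (S a) ≤ V)
    (hw0 : ∀ᵐ x ∂ν, 0 ≤ w x) (hwA : ∀ᵐ x ∂ν, w x ≤ A)
    (hN : ∀ᵐ x ∂ν, ∃ s : Finset ι, s.card ≤ N ∧ ∀ a ∉ s, f a x = 0)
    (hD : ∀ᵐ x ∂ν, ∀ a, ‖f a x‖ ≤ D) (hsupp : ∀ᵐ x ∂ν, ∀ a, f a x ≠ 0 → x ∈ S a)
    (u : ι → ℝ) :
    normSq (Matrix.of fun a b => ∫ x, w x * inner ℝ (f a x) (f b x) ∂ν) u ≤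
      A * N * D ^ 2 * V * ∑ a, u a ^ 2 := by
  have hint : ∀ a b, Integrable (fun x => w x * inner ℝ (f a x) (f b x)) ν := fun a b => by
    refine Integrable.of_bound (hw.mul ((hf a).inner (hf b))) (A * (D * D)) ?_
    filter_upwards [hw0, hwA, hD] with x h0 h1 h2
    rw [norm_mul, Real.norm_eq_abs, abs_of_nonneg h0]
    exact mul_le_mul h1 ((norm_inner_le_norm _ _).trans (mul_le_mul (h2 a) (h2 b) (norm_nonneg _)
      ((norm_nonneg _).trans (h2 a)))) (norm_nonneg _) hA
  have hexp : ∀ x, w x * ‖∑ a, u a • f a x‖ ^ 2 =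
      ∑ a, u a * ∑ b, (w x * inner ℝ (f a x) (f b x)) * u b := fun x => by
    rw [← real_inner_self_eq_norm_sq, sum_inner, Finset.mul_sum]
    refine Finset.sum_congr rfl fun a _ => ?_
    rw [inner_sum, Finset.mul_sum, Finset.mul_sum]
    refine Finset.sum_congr rfl fun b _ => ?_
    rw [real_inner_smul_left, real_inner_smul_right]; ring
  have hlhs : normSq (Matrix.of fun a b => ∫ x, w x * inner ℝ (f a x) (f b x) ∂ν) u =
      ∫ x, w x * ‖∑ a, u a • f a x‖ ^ 2 ∂ν := by
    simp only [hexp]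
    rw [integral_finsetSum _ fun a _ => (integrable_finsetSum _ fun b _ =>
      (hint a b).mul_const _).const_mul _]
    simp only [normSq, dotProduct, Matrix.mulVec, Matrix.of_apply]
    refine Finset.sum_congr rfl fun a _ => ?_
    rw [integral_const_mul, integral_finsetSum _ fun b _ => (hint a b).mul_const _]
    simp only [integral_mul_const]
  have hint' : Integrable (fun x => w x * ‖∑ a, u a • f a x‖ ^ 2) ν := by
    simp only [hexp]
    exact integrable_finsetSum _ fun a _ => (integrable_finsetSum _ fun b _ =>
      (hint a b).mul_const _).const_mul _
  have hind : ∀ a, Integrable (fun x => A * N * D ^ 2 * (u a ^ 2 * (S a).indicator 1 x)) ν :=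
    fun a => (((integrable_const (1 : ℝ)).indicator (hS a)).const_mul _).const_mul _
  rw [hlhs]
  calc ∫ x, w x * ‖∑ a, u a • f a x‖ ^ 2 ∂ν
      ≤ ∫ x, ∑ a, A * N * D ^ 2 * (u a ^ 2 * (S a).indicator 1 x) ∂ν := by
        refine integral_mono_ae hint' (integrable_finsetSum _ fun a _ => hind a) ?_
        filter_upwards [hw0, hwA, hN, hD, hsupp] with x h0 h1 ⟨s, hs, hs0⟩ h3 h4
        have e1 : ∑ a, u a • f a x = ∑ a ∈ s, u a • f a x :=
          (Finset.sum_subset (Finset.subset_univ _) fun a _ ha => by rw [hs0 a ha, smul_zero]).symm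
        -- Cauchy–Schwarz over the at most `N` indices that contribute at `x`; afterwards the sum
        -- may be enlarged to all indices.
        have e2 : ‖∑ a, u a • f a x‖ ^ 2 ≤ N * ∑ a, D ^ 2 * (u a ^ 2 * (S a).indicator 1 x) := by
          calc ‖∑ a, u a • f a x‖ ^ 2 ≤ (∑ a ∈ s, ‖u a • f a x‖) ^ 2 := by
                rw [e1]; gcongr; exact norm_sum_le _ _
            _ ≤ s.card * ∑ a ∈ s, ‖u a • f a x‖ ^ 2 := sq_sum_le_card_mul_sum_sq
            _ ≤ N * ∑ a, ‖u a • f a x‖ ^ 2 := by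
                gcongr
                exact Finset.subset_univ _
            _ ≤ _ := by
                gcongr with a _
                by_cases hx : x ∈ S a
                · rw [Set.indicator_of_mem hx, norm_smul, mul_pow, Real.norm_eq_abs, sq_abs]
                  simp only [Pi.one_apply, mul_one]
                  rw [mul_comm]
                  gcongr
                  exact h3 a
                · have : f a x = 0 := by
                    by_contra h; exact hx (h4 a h)
                  simp [this, hx]
        calc w x * ‖∑ a, u a • f a x‖ ^ 2
            ≤ A * (N * ∑ a, D ^ 2 * (u a ^ 2 * (S a).indicator 1 x)) := by gcongr
          _ = _ := by
            rw [Finset.mul_sum, Finset.mul_sum]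
            exact Finset.sum_congr rfl fun a _ => by ring
    _ = ∑ a, A * N * D ^ 2 * (u a ^ 2 * ν.real (S a)) := by
        rw [integral_finsetSum _ fun a _ => hind a]
        refine Finset.sum_congr rfl fun a _ => ?_
        rw [integral_const_mul, integral_const_mul, integral_indicator_one (hS a)]
    _ ≤ ∑ a, A * N * D ^ 2 * (u a ^ 2 * V) := by
        gcongr with a _
        exact hV a
    _ = A * N * D ^ 2 * V * ∑ a, u a ^ 2 := by
        rw [Finset.mul_sum]; exact Finset.sum_congr rfl fun a _ => by ring

/-! ### The reference simplex and its Lagrange basis -/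

/-- Barycentric coordinates on the reference simplex. -/
def refCoord {m : ℕ} (y : EuclideanSpace ℝ (Fin m)) : Fin (m + 1) → ℝ :=
  Fin.cons (1 - ∑ i, y i) fun i => y i

@[simp] theorem refCoord_zero {m : ℕ} (y : EuclideanSpace ℝ (Fin m)) :
    refCoord y 0 = 1 - ∑ i, y i := rfl

@[simp] theorem refCoord_succ {m : ℕ} (y : EuclideanSpace ℝ (Fin m)) (i : Fin m) :
    refCoord y i.succ = y i := rfl

theorem sum_refCoord {m : ℕ} (y : EuclideanSpace ℝ (Fin m)) : ∑ i, refCoord y i = 1 := by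
  rw [Fin.sum_univ_succ]; simp

theorem continuous_refCoord {m : ℕ} (i : Fin (m + 1)) :
    Continuous fun y : EuclideanSpace ℝ (Fin m) => refCoord y i := by
  refine Fin.cases ?_ (fun i => ?_) i
  · simp only [refCoord_zero]; fun_prop
  · simp only [refCoord_succ]; fun_prop

theorem exists_refCoord_eq {m : ℕ} {w : Fin (m + 1) → ℝ} (hw : ∑ i, w i = 1) :
    ∃ y : EuclideanSpace ℝ (Fin m), refCoord y = w := by
  refine ⟨WithLp.toLp 2 fun i => w i.succ, funext fun i => ?_⟩
  rw [Fin.sum_univ_succ] at hw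
  refine Fin.cases ?_ (fun i => ?_) i
  · simp only [refCoord_zero]; linarith
  · simp only [refCoord_succ]

theorem refCoord_segment {m : ℕ} (x y : EuclideanSpace ℝ (Fin m)) (ε : ℝ) (i : Fin (m + 1)) :
    refCoord (x + ε • (y - x)) i = (1 - ε) * refCoord x i + ε * refCoord y i := by
  refine Fin.cases ?_ (fun i => ?_) i
  · simp only [refCoord_zero, PiLp.add_apply, PiLp.smul_apply, PiLp.sub_apply, smul_eq_mul,
      Finset.sum_add_distrib, ← Finset.mul_sum, Finset.sum_sub_distrib]
    ring
  · simp only [refCoord_succ, PiLp.add_apply, PiLp.smul_apply, PiLp.sub_apply, smul_eq_mul]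
    ring

theorem abs_refCoord_sub_le {m : ℕ} (x y : EuclideanSpace ℝ (Fin m)) (i : Fin (m + 1)) :
    |refCoord x i - refCoord y i| ≤ (m + 1) * ‖x - y‖ := by
  have h : ∀ i, |x i - y i| ≤ ‖x - y‖ := fun i => by
    have := PiLp.norm_apply_le (x - y) i
    simpa using this
  have hn := norm_nonneg (x - y)
  refine Fin.cases ?_ (fun i => ?_) i
  · have : refCoord x 0 - refCoord y 0 = -∑ i, (x i - y i) := by
      simp only [refCoord_zero, Finset.sum_sub_distrib]; ring
    rw [this, abs_neg]
    refine (Finset.abs_sum_le_sum_abs _ _).trans ((Finset.sum_le_card_nsmul _ _ _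
      fun i _ => h i).trans ?_)
    simp only [Finset.card_univ, Fintype.card_fin, nsmul_eq_mul]
    linarith
  · simp only [refCoord_succ]
    refine (h i).trans ?_
    have : 0 ≤ (m : ℝ) * ‖x - y‖ := by positivity
    linarith

/-- The open reference simplex. -/
def refSimplex (m : ℕ) : Set (EuclideanSpace ℝ (Fin m)) := {y | ∀ i, 0 < refCoord y i}

theorem isOpen_refSimplex (m : ℕ) : IsOpen (refSimplex m) := by
  have : refSimplex m = ⋂ i, {y | 0 < refCoord y i} := by ext; simp [refSimplex]
  rw [this]
  exact isOpen_iInter_of_finite fun i => isOpen_lt continuous_const (continuous_refCoord i)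

theorem refSimplex_nonempty (m : ℕ) : (refSimplex m).Nonempty := by
  obtain ⟨y, hy⟩ := exists_refCoord_eq (w := fun _ : Fin (m + 1) => ((m : ℝ) + 1)⁻¹)
    (by simp; field_simp)
  refine ⟨y, fun i => ?_⟩
  rw [hy]; positivity

theorem norm_le_sum_abs {m : ℕ} (y : EuclideanSpace ℝ (Fin m)) : ‖y‖ ≤ ∑ i, |y i| := by
  rw [EuclideanSpace.norm_eq]
  refine Real.sqrt_le_iff.2 ⟨Finset.sum_nonneg fun _ _ => abs_nonneg _, ?_⟩
  simp only [Real.norm_eq_abs]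
  exact Finset.sum_sq_le_sq_sum_of_nonneg fun _ _ => abs_nonneg _

theorem norm_le_one_of_refCoord_nonneg {m : ℕ} {y : EuclideanSpace ℝ (Fin m)}
    (hy : ∀ i, 0 ≤ refCoord y i) : ‖y‖ ≤ 1 := by
  refine (norm_le_sum_abs y).trans ?_
  have h0 := hy 0
  have h1 : ∑ i, |y i| = ∑ i, y i :=
    Finset.sum_congr rfl fun i _ => abs_of_nonneg (by simpa using hy i.succ)
  rw [refCoord_zero] at h0
  linarith

theorem refSimplex_subset (m : ℕ) : refSimplex m ⊆ Metric.closedBall 0 1 := fun y hy => by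
  rw [mem_closedBall_zero_iff]
  exact norm_le_one_of_refCoord_nonneg fun i => (hy i).le

/-- The Lagrange multi-indices of degree `k` on the reference simplex. -/
abbrev RefIndex (m k : ℕ) : Type := {α : Fin (m + 1) → Fin (k + 1) // ∑ i, (α i : ℕ) = k}

/-- The Lagrange basis functions on the reference simplex. -/
def refShape {m k : ℕ} (α : RefIndex m k) (y : EuclideanSpace ℝ (Fin m)) : ℝ :=
  ∏ i, nodalFactor k (α.1 i) (refCoord y i)

theorem continuous_refShape {m k : ℕ} (α : RefIndex m k) : Continuous (refShape α) :=
  continuous_finsetProd _ fun i _ => (continuous_nodalFactor _ _).comp (continuous_refCoord i)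

/-- Both multi-indices sum to `k`, so if they differ then `β_i < α_i` for some `i`, and the factor
with `j = β_i` vanishes. Linear independence needs only a nonzero value at the own node, not the
value `1`. -/
theorem refShape_node {m k : ℕ} (hk : 1 ≤ k) {α β : RefIndex m k} {y : EuclideanSpace ℝ (Fin m)}
    (hy : ∀ i, refCoord y i = (β.1 i : ℕ) / (k : ℝ)) : refShape α y ≠ 0 ↔ α = β := by
  have hk' : (k : ℝ) ≠ 0 := by positivity
  have hval : ∀ i, (k : ℝ) * refCoord y i = (β.1 i : ℕ) := fun i => by rw [hy]; field_simp
  simp only [refShape, nodalFactor, hval, Finset.prod_ne_zero_iff]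
  constructor
  · intro h
    have hle : ∀ i ∈ Finset.univ, (α.1 i : ℕ) ≤ β.1 i := by
      intro i hi
      by_contra! hlt
      exact h i hi _ (Finset.mem_range.2 hlt) (by simp)
    have := (Finset.sum_eq_sum_iff_of_le hle).1 (by rw [α.2, β.2])
    exact Subtype.ext (funext fun i => Fin.ext (this i (Finset.mem_univ i)))
  · rintro rfl i - j hj
    have : (j : ℝ) < (α.1 i : ℕ) := by exact_mod_cast Finset.mem_range.1 hj
    exact div_ne_zero (by linarith) (by positivity)

theorem integrableOn_refSimplex {m : ℕ} {f : EuclideanSpace ℝ (Fin m) → ℝ} (hf : Continuous f) :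
    IntegrableOn f (refSimplex m) :=
  (hf.continuousOn.integrableOn_compact (isCompact_closedBall 0 1)).mono_set (refSimplex_subset m)

open Filter Topology in
/-- The reference basis functions are linearly independent on the open reference simplex. -/
theorem integral_refShape_pos {m k : ℕ} (hk : 1 ≤ k) {c : RefIndex m k → ℝ} (hc : c ≠ 0) :
    0 < ∫ y in refSimplex m, (∑ α, c α * refShape α y) ^ 2 := by
  have hcont : Continuous fun y : EuclideanSpace ℝ (Fin m) => ∑ α, c α * refShape α y :=
    continuous_finsetSum _ fun α _ => continuous_const.mul (continuous_refShape α)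
  refine lt_of_le_of_ne (integral_nonneg fun _ => sq_nonneg _) fun h => hc ?_
  rw [eq_comm, integral_eq_zero_iff_of_nonneg (fun _ => sq_nonneg _)
    (integrableOn_refSimplex (hcont.pow 2))] at h
  have h0 := Measure.eqOn_open_of_ae_eq h (isOpen_refSimplex m) (hcont.pow 2).continuousOn
    continuousOn_const
  funext β
  obtain ⟨x, hx⟩ := exists_refCoord_eq (w := fun i => ((β.1 i : ℕ) : ℝ) / k) (by
    have hk' : (k : ℝ) ≠ 0 := by positivity
    rw [← Finset.sum_div, ← Nat.cast_sum, β.2, div_self hk'])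
  have hx' := congrFun hx
  obtain ⟨y, hy⟩ := refSimplex_nonempty m
  -- Vanishing is known only on the open simplex, whereas the node `x` may lie on its boundary. It
  -- is reached as a limit along the segment from an interior point `y`.
  have hlim : Tendsto (fun ε : ℝ => (∑ α, c α * refShape α (x + ε • (y - x))) ^ 2) (𝓝[>] 0)
      (𝓝 ((∑ α, c α * refShape α x) ^ 2)) := by
    have : Continuous fun ε : ℝ => (∑ α, c α * refShape α (x + ε • (y - x))) ^ 2 :=
      (hcont.comp (by fun_prop : Continuous fun ε : ℝ => x + ε • (y - x))).pow 2
    simpa using (this.tendsto 0).mono_left nhdsWithin_le_nhds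
  have hzero : (∑ α, c α * refShape α x) ^ 2 = 0 := by
    refine tendsto_nhds_unique hlim (tendsto_const_nhds.congr' ?_)
    filter_upwards [Ioo_mem_nhdsGT (zero_lt_one' ℝ)] with ε hε
    refine (h0 fun i => ?_).symm
    rw [refCoord_segment, hx']
    have h1 : 0 ≤ (1 - ε) * (((β.1 i : ℕ) : ℝ) / k) :=
      mul_nonneg (by linarith [hε.2]) (by positivity)
    have h2 := mul_pos hε.1 (hy i)
    linarith
  rw [sq_eq_zero_iff, Finset.sum_eq_single β] at hzero
  · exact (mul_eq_zero.1 hzero).resolve_right ((refShape_node hk hx').2 rfl)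
  · intro α _ hα
    rw [not_not.1 (mt (refShape_node hk hx').1 hα), mul_zero]
  · simp

/-- On the reference simplex, the nodal values are controlled by the `L²` norm. -/
theorem exists_sum_sq_le_integral_refShape (m : ℕ) {k : ℕ} (hk : 1 ≤ k) :
    ∃ C : ℝ, 0 < C ∧ ∀ c : RefIndex m k → ℝ,
      ∑ α, c α ^ 2 ≤ C * ∫ y in refSimplex m, (∑ α, c α * refShape α y) ^ 2 := by
  set Q : (RefIndex m k → ℝ) → ℝ := fun c => ∫ y in refSimplex m, (∑ α, c α * refShape α y) ^ 2
    with hQ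
  have hQc : Continuous Q := by
    have : Q = fun c => ∑ α, ∑ β, c α * c β * ∫ y in refSimplex m, refShape α y * refShape β y := by
      funext c
      have hi : ∀ α β : RefIndex m k,
          IntegrableOn (fun y => c α * c β * (refShape α y * refShape β y)) (refSimplex m) :=
        fun α β => integrableOn_refSimplex
          (continuous_const.mul ((continuous_refShape α).mul (continuous_refShape β)))
      simp only [hQ, ← integral_const_mul]
      simp_rw [← integral_finsetSum _ fun β _ => hi _ β]
      rw [← integral_finsetSum _ fun α _ => integrable_finsetSum _ fun β _ => hi α β]
      refine integral_congr_ae (Filter.Eventually.of_forall fun y => ?_)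
      simp only [sq, Finset.sum_mul_sum]
      exact Finset.sum_congr rfl fun α _ => Finset.sum_congr rfl fun β _ => by ring
    rw [this]
    fun_prop
  have hQs : ∀ (t : ℝ) c, Q (t • c) = t ^ 2 * Q c := fun t c => by
    simp only [hQ, ← integral_const_mul, ← mul_pow, Finset.mul_sum, Pi.smul_apply, smul_eq_mul,
      mul_assoc]
  -- A continuous, positive quadratic form has a positive minimum on the compact unit sphere;
  -- homogeneity extends the bound to all vectors.
  obtain ⟨δ, hδ, hmin⟩ : ∃ δ : ℝ, 0 < δ ∧
      ∀ c ∈ Metric.sphere (0 : RefIndex m k → ℝ) 1, δ ≤ Q c := by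
    rcases (Metric.sphere (0 : RefIndex m k → ℝ) 1).eq_empty_or_nonempty with he | hne
    · exact ⟨1, one_pos, by simp [he]⟩
    · obtain ⟨c, hc, hm⟩ := (isCompact_sphere _ _).exists_isMinOn hne hQc.continuousOn
      refine ⟨Q c, integral_refShape_pos hk ?_, fun c' hc' => hm hc'⟩
      rintro rfl
      simp at hc
  -- The cardinality compares the sum of squares with the sup norm. The `+ 1` gives positivity
  -- without a proof that the index type is nonempty.
  refine ⟨(Fintype.card (RefIndex m k) + 1) / δ, by positivity, fun c => ?_⟩
  have h1 : δ * ‖c‖ ^ 2 ≤ Q c := by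
    rcases eq_or_ne c 0 with rfl | hc
    · simp only [norm_zero]
      have : 0 ≤ Q 0 := integral_nonneg fun _ => sq_nonneg _
      simpa using this
    · have hn := norm_pos_iff.2 hc
      have := hmin (‖c‖⁻¹ • c) (by simp [norm_smul, hn.ne'])
      rw [hQs, inv_pow, inv_mul_eq_div, le_div_iff₀ (by positivity)] at this
      exact this
  have h2 : ∑ α, c α ^ 2 ≤ Fintype.card (RefIndex m k) * ‖c‖ ^ 2 := by
    refine (Finset.sum_le_card_nsmul _ _ (‖c‖ ^ 2) fun α _ => ?_).trans (by simp)
    rw [← sq_abs]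
    gcongr
    exact norm_le_pi_norm c α
  rw [div_mul_eq_mul_div, le_div_iff₀ hδ]
  calc (∑ α, c α ^ 2) * δ ≤ Fintype.card (RefIndex m k) * ‖c‖ ^ 2 * δ := by gcongr
    _ = Fintype.card (RefIndex m k) * (δ * ‖c‖ ^ 2) := by ring
    _ ≤ (Fintype.card (RefIndex m k) + 1) * (δ * ‖c‖ ^ 2) := by gcongr; linarith
    _ ≤ _ := by gcongr

/-! ### Surface integrals over parametrized facets -/

/-- A one-sided change of variables that avoids Jacobians: a map that shrinks distances at most by
the factor `K` shrinks `m`-dimensional Hausdorff measure at most by `K ^ m`. The Lipschitz bound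
serves only to make `L` a measurable embedding, and its constant does not enter. -/
theorem integral_comp_le_of_antilipschitzWith {m : ℕ} {Y : Type*} [MetricSpace Y]
    [MeasurableSpace Y] [BorelSpace Y] {L : EuclideanSpace ℝ (Fin m) → Y} {K K' : NNReal}
    (hL : AntilipschitzWith K L) (hL' : LipschitzWith K' L) {D : Set (EuclideanSpace ℝ (Fin m))}
    {g : Y → ℝ} (hg0 : ∀ y, 0 ≤ g y)
    (hg : IntegrableOn g (L '' D) (Measure.euclideanHausdorffMeasure m)) :
    ∫ y in D, g (L y) ≤
      (K : ℝ) ^ m * ∫ x in L '' D, g x ∂(Measure.euclideanHausdorffMeasure m) := by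
  have hemb : MeasurableEmbedding L :=
    (hL.isClosedEmbedding hL'.uniformContinuous).measurableEmbedding
  have hle : (volume.restrict D).map L ≤
      (K ^ m) • (Measure.euclideanHausdorffMeasure m).restrict (L '' D) := by
    refine Measure.le_iff.2 fun S hS => ?_
    rw [Measure.map_apply hemb.measurable hS, Measure.restrict_apply (hemb.measurable hS),
      Measure.smul_apply, Measure.restrict_apply hS, Set.inter_comm S, ← Set.image_inter_preimage,
      ← EuclideanSpace.euclideanHausdorffMeasure_eq_volume, Set.inter_comm _ D,
      Measure.euclideanHausdorffMeasure_def, Measure.euclideanHausdorffMeasure_def,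
      Measure.smul_apply, Measure.smul_apply, smul_comm]
    gcongr
    refine (hL.le_hausdorffMeasure_image (Nat.cast_nonneg m) _).trans (le_of_eq ?_)
    rw [ENNReal.rpow_natCast, ENNReal.smul_def, ENNReal.coe_pow, smul_eq_mul]
  rw [← hemb.integral_map]
  refine (integral_mono_measure hle (Filter.Eventually.of_forall hg0)
    (hg.smul_measure_nnreal)).trans (le_of_eq ?_)
  rw [integral_smul_nnreal_measure, NNReal.smul_def, smul_eq_mul, NNReal.coe_pow]

/-- The affine parametrization of a facet over the reference simplex. -/
def facetMap {m : ℕ} {t : Finset (EuclideanSpace ℝ (Fin (m + 1)))} (e : Fin (m + 1) ≃ t)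
    (y : EuclideanSpace ℝ (Fin m)) : EuclideanSpace ℝ (Fin (m + 1)) :=
  ∑ i, refCoord y i • (e i : EuclideanSpace ℝ (Fin (m + 1)))

section facetMap
variable {m : ℕ} {t : Finset (EuclideanSpace ℝ (Fin (m + 1)))} (e : Fin (m + 1) ≃ t)

/-- The constant is immaterial, since it is used only for finiteness of the surface measure and for
measurability. -/
theorem exists_lipschitzWith_facetMap : ∃ K, LipschitzWith K (facetMap e) := by
  refine ⟨∑ i, (m + 1) * ‖(e i : EuclideanSpace ℝ (Fin (m + 1)))‖₊,
    LipschitzWith.of_dist_le_mul fun x y => ?_⟩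
  rw [dist_eq_norm, dist_eq_norm, facetMap, facetMap, ← Finset.sum_sub_distrib]
  refine (norm_sum_le _ _).trans ?_
  push_cast
  rw [Finset.sum_mul]
  refine Finset.sum_le_sum fun i _ => ?_
  rw [← sub_smul, norm_smul, Real.norm_eq_abs, mul_right_comm]
  gcongr
  exact abs_refCoord_sub_le x y i

theorem facetMap_mem_convexHull {y : EuclideanSpace ℝ (Fin m)} (hy : ∀ i, 0 ≤ refCoord y i) :
    facetMap e y ∈ convexHull ℝ (t : Set (EuclideanSpace ℝ (Fin (m + 1)))) :=
  (convex_convexHull ℝ _).sum_mem (fun i _ => hy i) (sum_refCoord y)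
    fun i _ => subset_convexHull ℝ _ (e i).2

theorem exists_facetMap_eq {x : EuclideanSpace ℝ (Fin (m + 1))}
    (hx : x ∈ convexHull ℝ (t : Set (EuclideanSpace ℝ (Fin (m + 1))))) :
    ∃ y, (∀ i, 0 ≤ refCoord y i) ∧ facetMap e y = x := by
  obtain ⟨w, h0, h1, hx⟩ := Finset.mem_convexHull'.1 hx
  obtain ⟨y, hy⟩ := exists_refCoord_eq
    (w := fun i => w (e i : EuclideanSpace ℝ (Fin (m + 1)))) (by
      rw [e.sum_comp (fun v : t => w v), Finset.univ_eq_attach, Finset.sum_attach t w, h1])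
  refine ⟨y, fun i => by rw [hy]; exact h0 _ (e i).2, ?_⟩
  rw [facetMap, hy, e.sum_comp (fun v : t => w v • (v : EuclideanSpace ℝ (Fin (m + 1)))),
    Finset.univ_eq_attach, Finset.sum_attach t fun v => w v • v, hx]

theorem euclideanHausdorffMeasure_convexHull_lt_top (ht : t.card = m + 1) :
    Measure.euclideanHausdorffMeasure m
      (convexHull ℝ (t : Set (EuclideanSpace ℝ (Fin (m + 1))))) < ⊤ := by
  have e : Fin (m + 1) ≃ t := (t.equivFinOfCardEq ht).symm
  obtain ⟨K, hK⟩ := exists_lipschitzWith_facetMap e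
  have hsub : convexHull ℝ (t : Set (EuclideanSpace ℝ (Fin (m + 1)))) ⊆
      facetMap e '' Metric.closedBall 0 1 := fun x hx => by
    obtain ⟨y, hy, rfl⟩ := exists_facetMap_eq e hx
    exact ⟨y, mem_closedBall_zero_iff.2 (norm_le_one_of_refCoord_nonneg hy), rfl⟩
  refine (measure_mono hsub).trans_lt ?_
  have h := hK.hausdorffMeasure_image_le (Nat.cast_nonneg m) (Metric.closedBall 0 1)
  have hv : (Measure.euclideanHausdorffMeasure m : Measure (EuclideanSpace ℝ (Fin m)))
      (Metric.closedBall 0 1) < ⊤ := by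
    rw [EuclideanSpace.euclideanHausdorffMeasure_eq_volume]
    exact measure_closedBall_lt_top
  rw [Measure.euclideanHausdorffMeasure_def, Measure.smul_apply] at hv ⊢
  have hne := Measure.addHaarScalarFactor_volume_hausdorffMeasure_ne_zero m
  rw [ENNReal.smul_def, smul_eq_mul] at hv ⊢
  refine ENNReal.mul_lt_top ENNReal.coe_lt_top (h.trans_lt ?_)
  refine ENNReal.mul_lt_top
    (by rw [ENNReal.rpow_natCast]; exact ENNReal.pow_lt_top ENNReal.coe_lt_top) ?_
  exact (ENNReal.lt_top_of_mul_ne_top_right hv.ne (by exact_mod_cast hne))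

end facetMap

/-! ### Nodal values on one facet -/

namespace Triangulation

variable {m : ℕ} {Ω : Set (EuclideanSpace ℝ (Fin (m + 1)))} {T : Triangulation (m + 1) Ω} {k : ℕ}
  {t : Finset (EuclideanSpace ℝ (Fin (m + 1)))}

/-- Affine maps respect combinations with weights of sum one. So the coordinates of an element above
the facet invert the parametrization, on all of `ℝ^m` and not only on the simplex. -/
theorem cellCoord_facetMap {s : Finset (EuclideanSpace ℝ (Fin (m + 1)))} (hs : s ∈ T.cells)
    (hts : t ⊆ s) (e : Fin (m + 1) ≃ t) (y : EuclideanSpace ℝ (Fin m)) (i : Fin (m + 1)) :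
    cellCoord hs (e i) (facetMap e y) = refCoord y i := by
  classical
  have h : ∀ x, cellCoord hs (e i) x =
      (cellCoord hs (e i)).linear x + cellCoord hs (e i) 0 := fun x => by
    simpa using (cellCoord hs (e i : EuclideanSpace ℝ (Fin (m + 1)))).map_vadd 0 x
  calc cellCoord hs (e i) (facetMap e y)
      = ∑ j, refCoord y j * cellCoord hs (e i) (e j) := by
        rw [h, facetMap, map_sum]
        simp only [fun j => h (e j : EuclideanSpace ℝ (Fin (m + 1))), map_smul, smul_eq_mul,
          mul_add, Finset.sum_add_distrib]
        rw [← Finset.sum_mul, sum_refCoord, one_mul]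
    _ = refCoord y i := by
        have : ∀ j, cellCoord hs (e i) (e j) = if i = j then 1 else 0 := fun j => by
          rw [cellCoord_vertex hs (hts (e i).2) (hts (e j).2)]
          simp
        simp [this]

/-- The `m` Cartesian components of the parameter are barycentric coordinates of the image, each
with Lipschitz constant `1 / r`; bounding the norm by the sum of components gives `m / r`. -/
theorem antilipschitzWith_facetMap {s : Finset (EuclideanSpace ℝ (Fin (m + 1)))} (hs : s ∈ T.cells)
    (hts : t ⊆ s) (e : Fin (m + 1) ≃ t) {c : EuclideanSpace ℝ (Fin (m + 1))} {r : ℝ} (hr : 0 < r)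
    (hc : Metric.closedBall c r ⊆ convexHull ℝ (s : Set (EuclideanSpace ℝ (Fin (m + 1))))) :
    AntilipschitzWith (Real.toNNReal (m / r)) (facetMap e) := by
  refine AntilipschitzWith.of_le_mul_dist fun x y => ?_
  rw [Real.coe_toNNReal _ (by positivity), dist_eq_norm, dist_eq_norm]
  refine (norm_le_sum_abs _).trans ((Finset.sum_le_card_nsmul _ _
    (‖facetMap e x - facetMap e y‖ / r) fun i _ => ?_).trans (le_of_eq ?_))
  · have := cellCoord_sub_le hs hr hc (e i.succ) (facetMap e x) (facetMap e y)
    rw [cellCoord_facetMap hs hts, cellCoord_facetMap hs hts] at this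
    simpa using this
  · simp only [Finset.card_univ, Fintype.card_fin, nsmul_eq_mul]
    ring

theorem bary_facetMap (ht : t ∈ T.faces) (e : Fin (m + 1) ≃ t) {y : EuclideanSpace ℝ (Fin m)}
    (hy : ∀ i, 0 ≤ refCoord y i) (i : Fin (m + 1)) :
    T.bary (facetMap e y) (e i) = refCoord y i := by
  obtain ⟨s, hs, hts⟩ := exists_cell_superset ht
  rw [bary_eq_cellCoord hs (convexHull_mono (Finset.coe_subset.2 hts)
    (facetMap_mem_convexHull e hy)), cellCoord_facetMap hs hts]

theorem support_bary_facetMap (ht : t ∈ T.faces) (e : Fin (m + 1) ≃ t)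
    {y : EuclideanSpace ℝ (Fin m)} (hy : y ∈ refSimplex m) :
    (T.bary (facetMap e y)).support = t := by
  have hmem := facetMap_mem_convexHull e fun i => (hy i).le
  refine Finset.Subset.antisymm
    ((mem_convexHull_iff_support (convexHull_face_subset ht hmem) ht).1 hmem) fun v hv => ?_
  have h := bary_facetMap ht e (fun i => (hy i).le) (e.symm ⟨v, hv⟩)
  rw [e.apply_symm_apply] at h
  rw [Finsupp.mem_support_iff, h]
  exact (hy _).ne'

/-- The reference multi-index of a node on a facet. -/
def Node.refIndex (e : Fin (m + 1) ≃ t) (a : {a : T.Node k // a.1.support ⊆ t}) : RefIndex m k :=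
  ⟨fun i => ⟨a.1.1 (e i), Nat.lt_succ_of_le (a.1.apply_le _)⟩, by
    change ∑ i, a.1.1 (e i : EuclideanSpace ℝ (Fin (m + 1))) = k
    rw [e.sum_comp (fun v : t => a.1.1 v), Finset.univ_eq_attach, Finset.sum_attach t a.1.1]
    exact (Finsupp.sum_of_support_subset _ a.2 _ fun _ _ => rfl).symm.trans a.1.2.2⟩

theorem Node.refIndex_injective (e : Fin (m + 1) ≃ t) :
    Function.Injective (Node.refIndex (T := T) (k := k) e) := by
  intro a b hab
  refine Subtype.ext (Subtype.ext (Finsupp.ext fun v => ?_))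
  by_cases hv : v ∈ t
  · have h1 := congrFun (congrArg Subtype.val hab) (e.symm ⟨v, hv⟩)
    have h2 := congrArg Fin.val h1
    simpa [Node.refIndex] using h2
  · rw [Finsupp.notMem_support_iff.1 fun h => hv (a.2 h),
      Finsupp.notMem_support_iff.1 fun h => hv (b.2 h)]

theorem nodalBasis_facetMap (ht : t ∈ T.faces) (e : Fin (m + 1) ≃ t)
    {y : EuclideanSpace ℝ (Fin m)} (hy : ∀ i, 0 ≤ refCoord y i)
    (a : {a : T.Node k // a.1.support ⊆ t}) :
    T.nodalBasis k a.1 (facetMap e y) = refShape (Node.refIndex e a) y := by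
  rw [nodalBasis_eq, Finset.prod_subset
    (f := fun v => nodalFactor k (a.1.1 v) (T.bary (facetMap e y) v)) a.2 fun v _ hv => by
      simp [Finsupp.notMem_support_iff.1 hv, nodalFactor]]
  rw [← Finset.prod_attach, ← Finset.univ_eq_attach, ← e.prod_comp, refShape]
  refine Finset.prod_congr rfl fun i _ => ?_
  rw [bary_facetMap ht e hy]
  rfl

/-- The finite element function with coefficient vector `u`. -/
def femFunction (u : T.Node k → ℝ) (x : EuclideanSpace ℝ (Fin (m + 1))) : ℝ :=
  ∑ a, u a * T.nodalBasis k a x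

open Classical in
-- Basis functions of nodes off the facet vanish on it, so the trace involves only its own nodal
-- values.
theorem femFunction_facetMap (ht : t ∈ T.faces) (e : Fin (m + 1) ≃ t)
    {y : EuclideanSpace ℝ (Fin m)} (hy : y ∈ refSimplex m) (u : T.Node k → ℝ) :
    femFunction u (facetMap e y) =
      ∑ a : {a : T.Node k // a.1.support ⊆ t}, u a.1 * refShape (Node.refIndex e a) y := by
  symm
  refine Fintype.sum_of_injective Subtype.val Subtype.val_injective _ _ (fun a ha => ?_) fun a => ?_
  · by_cases h : T.nodalBasis k a (facetMap e y) = 0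
    · rw [h, mul_zero]
    · refine absurd ⟨⟨a, ?_⟩, rfl⟩ ha
      exact (support_subset_of_nodalBasis_ne_zero h).trans (support_bary_facetMap ht e hy).subset
  · rw [nodalBasis_facetMap ht e fun i => (hy i).le]

/-- The relative interior of a simplex of the triangulation. -/
def openFacet (T : Triangulation (m + 1) Ω) (t : Finset (EuclideanSpace ℝ (Fin (m + 1)))) :
    Set (EuclideanSpace ℝ (Fin (m + 1))) :=
  {x ∈ convexHull ℝ (t : Set (EuclideanSpace ℝ (Fin (m + 1)))) | (T.bary x).support = t}

theorem image_refSimplex (ht : t ∈ T.faces) (e : Fin (m + 1) ≃ t) :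
    facetMap e '' refSimplex m = T.openFacet t := by
  refine Set.Subset.antisymm ?_ fun x ⟨hx, hxt⟩ => ?_
  · rintro _ ⟨y, hy, rfl⟩
    exact ⟨facetMap_mem_convexHull e fun i => (hy i).le, support_bary_facetMap ht e hy⟩
  · obtain ⟨y, hy, rfl⟩ := exists_facetMap_eq e hx
    refine ⟨y, fun i => lt_of_le_of_ne (hy i) ?_, rfl⟩
    rw [← bary_facetMap ht e hy]
    exact (Finsupp.mem_support_iff.1 (hxt.ge (e i).2)).symm

theorem measurableSet_openFacet {κ : ℝ} (hT : T.QuasiUniform κ) (hκ : 0 < κ)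
    (ht : t ∈ T.faces) (hc : t.card = m + 1) : MeasurableSet (T.openFacet t) := by
  have e : Fin (m + 1) ≃ t := (t.equivFinOfCardEq hc).symm
  obtain ⟨s, hs, hts⟩ := exists_cell_superset ht
  obtain ⟨c, hball⟩ := hT s hs
  have hr : 0 < T.meshWidth / κ := div_pos (meshWidth_pos (Nat.succ_ne_zero m) hs) hκ
  obtain ⟨K, hK⟩ := exists_lipschitzWith_facetMap e
  rw [← image_refSimplex ht e]
  exact ((antilipschitzWith_facetMap hs hts e hr hball).isClosedEmbedding
    hK.uniformContinuous).measurableEmbedding.measurableSet_image.2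
      (isOpen_refSimplex m).measurableSet

open Classical in
/-- On a facet, the nodal values are controlled by the surface `L²` norm. -/
theorem sum_sq_le_integral_openFacet {C : ℝ} (hC0 : 0 ≤ C)
    (hC : ∀ c : RefIndex m k → ℝ,
      ∑ α, c α ^ 2 ≤ C * ∫ y in refSimplex m, (∑ α, c α * refShape α y) ^ 2)
    {κ : ℝ} (hT : T.QuasiUniform κ) (hκ : 0 < κ) (ht : t ∈ T.faces) (hc : t.card = m + 1)
    (u : T.Node k → ℝ)
    (hu : IntegrableOn (fun x => femFunction u x ^ 2) (T.openFacet t)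
      (Measure.euclideanHausdorffMeasure m)) :
    ∑ a : {a : T.Node k // a.1.support ⊆ t}, u a.1 ^ 2 ≤
      C * (m * κ / T.meshWidth) ^ m *
        ∫ x in T.openFacet t, femFunction u x ^ 2 ∂(Measure.euclideanHausdorffMeasure m) := by
  have e : Fin (m + 1) ≃ t := (t.equivFinOfCardEq hc).symm
  obtain ⟨s, hs, hts⟩ := exists_cell_superset ht
  obtain ⟨c, hball⟩ := hT s hs
  have hh := meshWidth_pos (Nat.succ_ne_zero m) hs
  have hr : 0 < T.meshWidth / κ := div_pos hh hκ
  obtain ⟨K, hK⟩ := exists_lipschitzWith_facetMap e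
  -- Extension by zero to all reference multi-indices, so that injectivity of `Node.refIndex`
  -- suffices.
  set c : RefIndex m k → ℝ :=
    Function.extend (Node.refIndex (T := T) (k := k) e) (fun a => u a.1) 0 with hcdef
  have hinj := Node.refIndex_injective (T := T) (k := k) e
  have hca : ∀ a : {a : T.Node k // a.1.support ⊆ t}, c (Node.refIndex e a) = u a.1 := fun a =>
    hinj.extend_apply _ _ _
  have hc0 : ∀ α ∉ Set.range (Node.refIndex (T := T) (k := k) e), c α = 0 := fun α hα =>
    Function.extend_apply' _ _ _ hα
  have h1 : ∑ a : {a : T.Node k // a.1.support ⊆ t}, u a.1 ^ 2 = ∑ α, c α ^ 2 :=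
    Fintype.sum_of_injective _ hinj _ _ (fun α hα => by rw [hc0 α hα]; simp) fun a => by rw [hca]
  have h2 : ∫ y in refSimplex m, (∑ α, c α * refShape α y) ^ 2 =
      ∫ y in refSimplex m, femFunction u (facetMap e y) ^ 2 := by
    refine setIntegral_congr_fun (isOpen_refSimplex m).measurableSet fun y hy => ?_
    rw [femFunction_facetMap ht e hy, Fintype.sum_of_injective _ hinj
      (fun a => u a.1 * refShape (Node.refIndex e a) y) (fun α => c α * refShape α y)
      (fun α hα => by rw [hc0 α hα, zero_mul]) fun a => by rw [hca]]
  have h3 := integral_comp_le_of_antilipschitzWith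
    (antilipschitzWith_facetMap hs hts e hr hball) hK (D := refSimplex m)
    (g := fun x => femFunction u x ^ 2) (fun _ => sq_nonneg _)
    (by rw [image_refSimplex ht e]; exact hu)
  rw [image_refSimplex ht e, Real.coe_toNNReal _ (by positivity)] at h3
  have h4 : (m : ℝ) / (T.meshWidth / κ) = m * κ / T.meshWidth := by field_simp
  rw [h4] at h3
  rw [h1, mul_assoc]
  refine (hC c).trans ?_
  rw [h2]
  gcongr

end Triangulation

/-! ### Boundary nodal values and the `L²(Γ)` norm -/

namespace Triangulation

variable {m : ℕ} {Ω : Set (EuclideanSpace ℝ (Fin (m + 1)))} {T : Triangulation (m + 1) Ω} {k : ℕ}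

theorem surfaceMeasure_eq (Ω : Set (EuclideanSpace ℝ (Fin (m + 1)))) :
    surfaceMeasure Ω = (Measure.euclideanHausdorffMeasure m).restrict (frontier Ω) := rfl

theorem isFiniteMeasure_surfaceMeasure (T : Triangulation (m + 1) Ω)
    (hΩ : interior (closure Ω) = Ω) : IsFiniteMeasure (surfaceMeasure Ω) := by
  rw [surfaceMeasure_eq, isFiniteMeasure_restrict]
  have hsub : frontier Ω ⊆ ⋃ t ∈ {t ∈ T.faces | t.card = m + 1},
      convexHull ℝ (t : Set (EuclideanSpace ℝ (Fin (m + 1)))) := fun x hx => by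
    obtain ⟨t, ht, hc, hxt, -⟩ := exists_facet_of_mem_frontier (T := T) hΩ hx
    exact Set.mem_biUnion ⟨ht, hc⟩ hxt
  exact ((measure_mono hsub).trans_lt (measure_biUnion_lt_top
    (T.finite_faces.subset fun _ h => h.1)
    fun _ ht => euclideanHausdorffMeasure_convexHull_lt_top ht.2)).ne

theorem memLp_of_mem_lagrangeSpace (hΩ : interior (closure Ω) = Ω)
    {v : EuclideanSpace ℝ (Fin (m + 1)) → ℝ} (hv : v ∈ T.lagrangeSpace k) :
    MemLp v 2 (surfaceMeasure Ω) := by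
  have := T.isFiniteMeasure_surfaceMeasure hΩ
  have hc : ContinuousOn v (frontier Ω) := hv.1.mono frontier_subset_closure
  obtain ⟨C, hC⟩ := (T.isCompact_closure.of_isClosed_subset isClosed_frontier
    frontier_subset_closure).exists_bound_of_continuousOn hc
  exact MemLp.of_bound (hc.aestronglyMeasurable isClosed_frontier.measurableSet) C
    ((ae_restrict_mem isClosed_frontier.measurableSet).mono hC)

theorem femFunction_mem (u : T.Node k → ℝ) : femFunction u ∈ T.lagrangeSpace k := by
  have : femFunction u = ∑ a, u a • T.nodalBasis k a := by
    funext x; simp [femFunction, Finset.sum_apply]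
  rw [this]
  exact Submodule.sum_mem _ fun a _ => Submodule.smul_mem _ _ (nodalBasis_mem a)

open Classical in
/-- The nodal values on the boundary are controlled by the surface `L²` norm. -/
theorem sum_sq_boundary_le (hk : 1 ≤ k) (hΩ : interior (closure Ω) = Ω) {C : ℝ} (hC0 : 0 ≤ C)
    (hC : ∀ c : RefIndex m k → ℝ,
      ∑ α, c α ^ 2 ≤ C * ∫ y in refSimplex m, (∑ α, c α * refShape α y) ^ 2)
    {κ : ℝ} (hT : T.QuasiUniform κ) (hκ : 0 < κ) (u : T.Node k → ℝ) :
    ∑ a, boundaryPart u a ^ 2 ≤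
      C * (m * κ / T.meshWidth) ^ m * ∫ x, femFunction u x ^ 2 ∂(surfaceMeasure Ω) := by
  have hh : 0 ≤ T.meshWidth := Real.sSup_nonneg (by
    rintro _ ⟨s, _, rfl⟩; exact Metric.diam_nonneg)
  set B : Finset (Finset (EuclideanSpace ℝ (Fin (m + 1)))) := T.finite_faces.toFinset.filter
    fun t => t.card = m + 1 ∧
      convexHull ℝ (t : Set (EuclideanSpace ℝ (Fin (m + 1)))) ⊆ frontier Ω with hB
  have hBmem : ∀ t ∈ B, t ∈ T.faces ∧ t.card = m + 1 ∧
      convexHull ℝ (t : Set (EuclideanSpace ℝ (Fin (m + 1)))) ⊆ frontier Ω := fun t ht => by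
    simpa [hB] using ht
  have hint : Integrable (fun x => femFunction u x ^ 2) (surfaceMeasure Ω) :=
    (memLp_of_mem_lagrangeSpace hΩ (femFunction_mem u)).integrable_sq
  have hsub : ∀ t ∈ B, T.openFacet t ⊆ frontier Ω := fun t ht x hx => (hBmem t ht).2.2 hx.1
  have hint' : ∀ t ∈ B, IntegrableOn (fun x => femFunction u x ^ 2) (T.openFacet t)
      (Measure.euclideanHausdorffMeasure m) := fun t ht =>
    IntegrableOn.mono_set (t := frontier Ω) hint (hsub t ht)
  have hmeas : ∀ t ∈ B, MeasurableSet (T.openFacet t) := fun t ht =>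
    measurableSet_openFacet hT hκ (hBmem t ht).1 (hBmem t ht).2.1
  have hfacet : ∀ t ∈ B, ∑ a : T.Node k, (if a.1.support ⊆ t then u a ^ 2 else 0) ≤
      C * (m * κ / T.meshWidth) ^ m *
        ∫ x in T.openFacet t, femFunction u x ^ 2 ∂(Measure.euclideanHausdorffMeasure m) := by
    intro t ht
    refine le_trans (le_of_eq ?_) (sum_sq_le_integral_openFacet hC0 hC hT hκ (hBmem t ht).1
      (hBmem t ht).2.1 u (hint' t ht))
    rw [← Finset.sum_filter]
    exact Finset.sum_subtype _ (by simp) _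
  -- Relatively open facets are disjoint because a point determines its support; their integrals
  -- thus add up without a discussion of null overlaps.
  have hdisj : (B : Set (Finset (EuclideanSpace ℝ (Fin (m + 1))))).Pairwise
      (Function.onFun Disjoint fun t => T.openFacet t) := fun t _ t' _ htt' =>
    Set.disjoint_left.2 fun x hx hx' => htt' (hx.2.symm.trans hx'.2)
  calc ∑ a, boundaryPart u a ^ 2
      ≤ ∑ a : T.BoundaryNode k, ∑ t ∈ B, if a.1.1.support ⊆ t then u a.1 ^ 2 else 0 := by
        refine Finset.sum_le_sum fun a _ => ?_
        -- One facet through the node is enough. Nodes on several facets are counted repeatedly,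
        -- which only enlarges the right side.
        obtain ⟨t, ht, hc, hat, hfr⟩ := exists_facet_of_mem_frontier (T := T) hΩ a.2
        have htB : t ∈ B := by simp [hB, ht, hc, hfr]
        refine le_trans (le_of_eq ?_) (Finset.single_le_sum (fun t _ => ?_) htB)
        · rw [if_pos (a.1.support_subset hk ht hat)]; rfl
        · split_ifs
          · exact sq_nonneg _
          · exact le_rfl
    _ = ∑ t ∈ B, ∑ a : T.BoundaryNode k, if a.1.1.support ⊆ t then u a.1 ^ 2 else 0 :=
        Finset.sum_comm
    _ ≤ ∑ t ∈ B, ∑ a : T.Node k, if a.1.support ⊆ t then u a ^ 2 else 0 := by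
        refine Finset.sum_le_sum fun t _ => ?_
        refine le_trans (le_of_eq (Finset.sum_map Finset.univ
          (⟨Subtype.val, Subtype.val_injective⟩ : T.BoundaryNode k ↪ T.Node k)
          fun a => if a.1.support ⊆ t then u a ^ 2 else 0).symm) ?_
        refine Finset.sum_le_sum_of_subset_of_nonneg (Finset.subset_univ _) fun a _ _ => ?_
        split_ifs
        · exact sq_nonneg _
        · exact le_rfl
    _ ≤ ∑ t ∈ B, C * (m * κ / T.meshWidth) ^ m *
        ∫ x in T.openFacet t, femFunction u x ^ 2 ∂(Measure.euclideanHausdorffMeasure m) :=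
        Finset.sum_le_sum hfacet
    _ = C * (m * κ / T.meshWidth) ^ m * ∫ x in ⋃ t ∈ B, T.openFacet t,
          femFunction u x ^ 2 ∂(Measure.euclideanHausdorffMeasure m) := by
        rw [integral_biUnion_finset B hmeas hdisj hint', Finset.mul_sum]
    _ ≤ _ := by
        refine mul_le_mul_of_nonneg_left ?_ (by positivity)
        exact setIntegral_mono_set hint (Filter.Eventually.of_forall fun _ => sq_nonneg _)
          (LE.le.eventuallyLE (Set.iUnion₂_subset hsub))

end Triangulation

/-! ### The coupling condition as an `L²(Γ)` projection -/

theorem integral_sum_mul_sum {d : ℕ} {Ω : Set (EuclideanSpace ℝ (Fin d))} {ι ι' : Type*}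
    [Fintype ι] [Fintype ι'] {f : ι → EuclideanSpace ℝ (Fin d) → ℝ}
    {g : ι' → EuclideanSpace ℝ (Fin d) → ℝ} (hf : ∀ i, MemLp (f i) 2 (surfaceMeasure Ω))
    (hg : ∀ i, MemLp (g i) 2 (surfaceMeasure Ω)) (c : ι → ℝ) (x : ι' → ℝ) :
    ∫ y, (∑ i, c i * f i y) * (∑ j, x j * g j y) ∂(surfaceMeasure Ω) =
      c ⬝ᵥ (surfaceMatrix Ω f g).mulVec x := by
  have hi : ∀ i j, Integrable (fun y => (c i * f i y) * (x j * g j y)) (surfaceMeasure Ω) :=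
    fun i j => ((hf i).const_mul (c i)).integrable_mul ((hg j).const_mul (x j))
  simp only [Finset.sum_mul_sum]
  rw [integral_finsetSum _ fun i _ => integrable_finsetSum _ fun j _ => hi i j]
  simp only [dotProduct, Matrix.mulVec, surfaceMatrix, Matrix.of_apply, Finset.mul_sum]
  refine Finset.sum_congr rfl fun i _ => ?_
  rw [integral_finsetSum _ fun j _ => hi i j]
  refine Finset.sum_congr rfl fun j _ => ?_
  rw [← integral_mul_const, ← integral_const_mul]
  exact integral_congr_ae (Filter.Eventually.of_forall fun y => by ring)

namespace Triangulation

variable {m : ℕ} {Ω : Set (EuclideanSpace ℝ (Fin (m + 1)))} {T : Triangulation (m + 1) Ω} {k : ℕ}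

/-- The condition `B_u u = B_p p` says that the trace of the bulk function is the `L²` projection
of the surface function, so that its norm is not larger. -/
theorem integral_femFunction_sq_le (hΩ : interior (closure Ω) = Ω) {Nl Np : ℕ}
    {μ : Fin Nl → EuclideanSpace ℝ (Fin (m + 1)) → ℝ}
    (hμ : (T.lagrangeSpace k).map (traceMap Ω) =
      Submodule.span ℝ (Set.range fun i => traceMap Ω (μ i)))
    {ψ : Fin Np → EuclideanSpace ℝ (Fin (m + 1)) → ℝ}
    (hψ : ∀ j, MemLp (ψ j) 2 (surfaceMeasure Ω)) {u : T.Node k → ℝ} {p : Fin Np → ℝ}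
    (hup : (surfaceMatrix Ω μ (T.nodalBasis k)).mulVec u = (surfaceMatrix Ω μ ψ).mulVec p) :
    ∫ x, femFunction u x ^ 2 ∂(surfaceMeasure Ω) ≤ normSq (surfaceMatrix Ω ψ ψ) p := by
  have hfr : ∀ᵐ x ∂(surfaceMeasure Ω), x ∈ frontier Ω :=
    ae_restrict_mem isClosed_frontier.measurableSet
  have hμL : ∀ i, MemLp (μ i) 2 (surfaceMeasure Ω) := fun i => by
    have : traceMap Ω (μ i) ∈ (T.lagrangeSpace k).map (traceMap Ω) := by
      rw [hμ]; exact Submodule.subset_span ⟨i, rfl⟩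
    obtain ⟨v, hv, hvi⟩ := this
    refine (memLp_of_mem_lagrangeSpace hΩ hv).ae_eq ?_
    filter_upwards [hfr] with x hx using congrFun hvi ⟨x, hx⟩
  have hφL : ∀ a, MemLp (T.nodalBasis k a) 2 (surfaceMeasure Ω) := fun a =>
    memLp_of_mem_lagrangeSpace hΩ (nodalBasis_mem a)
  have huL := memLp_of_mem_lagrangeSpace hΩ (femFunction_mem u)
  -- The trace of `u_h` is itself a test function. Pairing the coupling condition with its
  -- coefficients `c` gives `(u_h, u_h) = (u_h, w)` on `Γ`.
  obtain ⟨c, hc⟩ : ∃ c : Fin Nl → ℝ, ∑ i, c i • traceMap Ω (μ i) = traceMap Ω (femFunction u) := by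
    rw [← Submodule.mem_span_range_iff_exists_fun, ← hμ]
    exact Submodule.mem_map_of_mem (femFunction_mem u)
  have hcu : ∀ᵐ x ∂(surfaceMeasure Ω), femFunction u x = ∑ i, c i * μ i x := by
    filter_upwards [hfr] with x hx
    have := congrFun hc ⟨x, hx⟩
    simp only [Finset.sum_apply, Pi.smul_apply, smul_eq_mul] at this
    exact this.symm
  set w : EuclideanSpace ℝ (Fin (m + 1)) → ℝ := fun x => ∑ j, p j * ψ j x with hw
  have hwL : MemLp w 2 (surfaceMeasure Ω) :=
    memLp_finsetSum _ fun j _ => (hψ j).const_mul (p j)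
  have huu : ∫ x, femFunction u x ^ 2 ∂(surfaceMeasure Ω) =
      ∫ x, femFunction u x * w x ∂(surfaceMeasure Ω) := by
    calc ∫ x, femFunction u x ^ 2 ∂(surfaceMeasure Ω)
        = ∫ x, (∑ i, c i * μ i x) * (∑ a, u a * T.nodalBasis k a x) ∂(surfaceMeasure Ω) := by
          refine integral_congr_ae ?_
          filter_upwards [hcu] with x hx
          rw [← hx, sq]; rfl
      _ = ∫ x, (∑ i, c i * μ i x) * (∑ j, p j * ψ j x) ∂(surfaceMeasure Ω) := by
          rw [integral_sum_mul_sum hμL hφL, integral_sum_mul_sum hμL hψ, hup]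
      _ = ∫ x, femFunction u x * w x ∂(surfaceMeasure Ω) := by
          refine integral_congr_ae ?_
          filter_upwards [hcu] with x hx
          rw [← hx]
  have hww : normSq (surfaceMatrix Ω ψ ψ) p = ∫ x, w x ^ 2 ∂(surfaceMeasure Ω) := by
    rw [normSq, ← integral_sum_mul_sum hψ hψ]
    simp only [hw, sq]
  -- By `huu`, the square expands to `‖w‖² - ‖u_h‖²`.
  have h0 : 0 ≤ ∫ x, (w x - femFunction u x) ^ 2 ∂(surfaceMeasure Ω) :=
    integral_nonneg fun _ => sq_nonneg _
  have hexp : ∫ x, (w x - femFunction u x) ^ 2 ∂(surfaceMeasure Ω) =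
      ∫ x, w x ^ 2 ∂(surfaceMeasure Ω) - 2 * ∫ x, femFunction u x * w x ∂(surfaceMeasure Ω) +
        ∫ x, femFunction u x ^ 2 ∂(surfaceMeasure Ω) := by
    have i1 := hwL.integrable_sq
    have i2 : Integrable (fun x => 2 * (femFunction u x * w x)) (surfaceMeasure Ω) :=
      (huL.integrable_mul hwL).const_mul 2
    have i3 : Integrable (fun x => w x ^ 2 - 2 * (femFunction u x * w x)) (surfaceMeasure Ω) :=
      i1.sub i2
    rw [← integral_const_mul, ← integral_sub i1 i2, ← integral_add i3 huL.integrable_sq]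
    exact integral_congr_ae (Filter.Eventually.of_forall fun x => by ring)
  rw [hww]
  linarith

/-! ### Upper bounds for the boundary blocks -/

theorem isFiniteMeasure_restrict_domain (T : Triangulation (m + 1) Ω) :
    IsFiniteMeasure (volume.restrict Ω) := by
  rw [isFiniteMeasure_restrict]
  exact ((measure_mono subset_closure).trans_lt T.isCompact_closure.measure_lt_top).ne

theorem measureReal_restrict_closedBall_le (z : EuclideanSpace ℝ (Fin (m + 1))) {h : ℝ}
    (hh : 0 ≤ h) : (volume.restrict Ω).real (Metric.closedBall z h) ≤
      h ^ (m + 1) * volume.real (Metric.ball (0 : EuclideanSpace ℝ (Fin (m + 1))) 1) := by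
  have h1 := Measure.addHaar_real_closedBall
    (volume : Measure (EuclideanSpace ℝ (Fin (m + 1)))) z hh
  rw [finrank_euclideanSpace_fin] at h1
  rw [← h1, measureReal_def, measureReal_def]
  exact ENNReal.toReal_mono measure_closedBall_lt_top.ne (Measure.restrict_apply_le _ _)

open Classical in
theorem exists_finset_boundaryNode (s : Finset (EuclideanSpace ℝ (Fin (m + 1))))
    (hs : s ∈ T.cells) :
    ∃ S : Finset (T.BoundaryNode k), S.card ≤ (k + 1) ^ (m + 2) ∧
      ∀ a ∉ S, ¬ a.1.1.support ⊆ s :=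
  ⟨Finset.univ.filter fun a => a.1.1.support ⊆ s,
    hs.2 ▸ card_boundaryNode_le _ fun _ ha => (Finset.mem_filter.1 ha).2,
    fun _ ha h => ha (Finset.mem_filter.2 ⟨Finset.mem_univ _, h⟩)⟩

/-- Each basis function lives, almost everywhere, in the ball of radius `h` around its node, so its
support has volume `O(h^{m+1})` without any count of elements in a patch. The exponent `m + 2` is
the number of vertices of an element. -/
theorem normSq_boundaryBlock_massMatrix_le (hk : 1 ≤ k) (u : T.BoundaryNode k → ℝ) :
    normSq (boundaryBlock (T.massMatrix k)) u ≤
      1 * ((k + 1) ^ (m + 2) : ℕ) * nodalBound k ^ 2 * (T.meshWidth ^ (m + 1) *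
        volume.real (Metric.ball (0 : EuclideanSpace ℝ (Fin (m + 1))) 1)) * ∑ a, u a ^ 2 := by
  have := T.isFiniteMeasure_restrict_domain
  have hh : 0 ≤ T.meshWidth := Real.sSup_nonneg (by
    rintro _ ⟨s, _, rfl⟩; exact Metric.diam_nonneg)
  have hM : boundaryBlock (T.massMatrix k) = Matrix.of fun a b : T.BoundaryNode k =>
      ∫ x in Ω, (1 : ℝ) * inner ℝ (T.nodalBasis k a.1 x) (T.nodalBasis k b.1 x) := by
    ext a b
    simp only [boundaryBlock, massMatrix, Matrix.submatrix_apply, Matrix.of_apply, one_mul]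
    exact integral_congr_ae (Filter.Eventually.of_forall fun x => mul_comm _ _)
  have hmem : ∀ (a : T.BoundaryNode k) {s : Finset (EuclideanSpace ℝ (Fin (m + 1)))} {x},
      s ∈ T.cells → x ∈ interior (convexHull ℝ (s : Set (EuclideanSpace ℝ (Fin (m + 1))))) →
      T.nodalBasis k a.1 x ≠ 0 → a.1.1.support ⊆ s := fun a s x hs hx h => by
    have hx := interior_subset hx
    exact (support_subset_of_nodalBasis_ne_zero h).trans
      ((mem_convexHull_iff_support (convexHull_face_subset hs.1 hx) hs.1).1 hx)
  rw [hM]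
  refine gram_quadratic_form_le (volume.restrict Ω)
    (S := fun a : T.BoundaryNode k => Metric.closedBall a.1.point T.meshWidth) zero_le_one
    aestronglyMeasurable_const (fun a => ?_) (fun a => Metric.isClosed_closedBall.measurableSet)
    (fun a => measureReal_restrict_closedBall_le _ hh) (Filter.Eventually.of_forall fun _ =>
      zero_le_one) (Filter.Eventually.of_forall fun _ => le_rfl) ?_
    (Filter.Eventually.of_forall fun x a => abs_nodalBasis_le hk a.1 x) ?_ u
  · exact ((nodalBasis_mem a.1).1.aestronglyMeasurable
      isClosed_closure.measurableSet).mono_measure (Measure.restrict_mono subset_closure le_rfl)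
  · filter_upwards [T.ae_mem_interior_cell] with x ⟨s, hs, hx⟩
    obtain ⟨S, hS, hS'⟩ := exists_finset_boundaryNode (k := k) s hs
    refine ⟨S, hS, fun a ha => ?_⟩
    by_contra h
    exact hS' a ha (hmem a hs hx h)
  · filter_upwards [T.ae_mem_interior_cell] with x ⟨s, hs, hx⟩ a h
    exact dist_le_meshWidth hs (interior_subset hx)
      (a.1.point_mem_convexHull hk (hmem a hs hx h))

/-- As for the mass matrix, with gradients of size `O(κ / h)` in place of bounded values, and with
weight `α`. -/
theorem normSq_boundaryBlock_stiffnessMatrix_le (hk : 1 ≤ k) {κ : ℝ} (hκ : 0 < κ)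
    (hT : T.QuasiUniform κ) {α : EuclideanSpace ℝ (Fin (m + 1)) → ℝ} {A : ℝ} (hA : 0 ≤ A)
    (hα : AEStronglyMeasurable α (volume.restrict Ω)) (hα0 : ∀ᵐ x ∂(volume.restrict Ω), 0 ≤ α x)
    (hαA : ∀ᵐ x ∂(volume.restrict Ω), α x ≤ A) (u : T.BoundaryNode k → ℝ) :
    normSq (boundaryBlock (T.stiffnessMatrix k α)) u ≤
      A * ((k + 1) ^ (m + 2) : ℕ) * (nodalLipBound k / (T.meshWidth / κ)) ^ 2 *
        (T.meshWidth ^ (m + 1) *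
          volume.real (Metric.ball (0 : EuclideanSpace ℝ (Fin (m + 1))) 1)) * ∑ a, u a ^ 2 := by
  have := T.isFiniteMeasure_restrict_domain
  have hh : 0 ≤ T.meshWidth := Real.sSup_nonneg (by
    rintro _ ⟨s, _, rfl⟩; exact Metric.diam_nonneg)
  have hmem : ∀ (a : T.BoundaryNode k) {s : Finset (EuclideanSpace ℝ (Fin (m + 1)))} {x},
      s ∈ T.cells → x ∈ interior (convexHull ℝ (s : Set (EuclideanSpace ℝ (Fin (m + 1))))) →
      ∇ (T.nodalBasis k a.1) x ≠ 0 → a.1.1.support ⊆ s := fun a s x hs hx h => by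
    by_contra ha
    exact h (gradient_nodalBasis_eq_zero a.1 hs ha hx)
  have hM : boundaryBlock (T.stiffnessMatrix k α) = Matrix.of fun a b : T.BoundaryNode k =>
      ∫ x in Ω, α x * inner ℝ (∇ (T.nodalBasis k a.1) x) (∇ (T.nodalBasis k b.1) x) := rfl
  rw [hM]
  refine gram_quadratic_form_le (volume.restrict Ω)
    (S := fun a : T.BoundaryNode k => Metric.closedBall a.1.point T.meshWidth) hA hα
    (fun a => ?_) (fun a => Metric.isClosed_closedBall.measurableSet)
    (fun a => measureReal_restrict_closedBall_le _ hh) hα0 hαA ?_ ?_ ?_ u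
  · exact ((InnerProductSpace.toDual ℝ _).symm.continuous.measurable.comp
      (measurable_fderiv ℝ (T.nodalBasis k a.1))).aestronglyMeasurable
  · filter_upwards [T.ae_mem_interior_cell] with x ⟨s, hs, hx⟩
    obtain ⟨S, hS, hS'⟩ := exists_finset_boundaryNode (k := k) s hs
    refine ⟨S, hS, fun a ha => ?_⟩
    by_contra h
    exact hS' a ha (hmem a hs hx h)
  · filter_upwards [T.ae_mem_interior_cell] with x ⟨s, hs, hx⟩ a
    obtain ⟨c, hc⟩ := hT s hs
    exact norm_gradient_nodalBasis_le hk a.1 hs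
      (div_pos (meshWidth_pos (Nat.succ_ne_zero m) hs) hκ) hc hx
  · filter_upwards [T.ae_mem_interior_cell] with x ⟨s, hs, hx⟩ a h
    exact dist_le_meshWidth hs (interior_subset hx)
      (a.1.point_mem_convexHull hk (hmem a hs hx h))

end Triangulation

/-! ### Assembly of the constants -/

/-- The bound `A` is factored out, so both constants depend only on `m`, `k` and `κ`. The two
nonnegativity claims allow the constants to be enlarged later. -/
theorem exists_boundary_constants (m k : ℕ) (hk : 1 ≤ k) (κ : ℝ) (hκ : 0 < κ) :
    ∃ c_M c_K : ℝ, 0 < c_M ∧ 0 < c_K ∧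
      ∀ (Ω : Set (EuclideanSpace ℝ (Fin (m + 1)))) (_ : interior (closure Ω) = Ω)
        (T : Triangulation (m + 1) Ω) (_ : T.QuasiUniform κ)
        (α : EuclideanSpace ℝ (Fin (m + 1)) → ℝ)
        (_ : AEStronglyMeasurable α (volume.restrict Ω))
        (_ : ∀ᵐ x ∂(volume.restrict Ω), 0 ≤ α x) (A : ℝ) (_ : 0 ≤ A)
        (_ : ∀ᵐ x ∂(volume.restrict Ω), α x ≤ A)
        (Nl Np : ℕ)
        (μ : Fin Nl → EuclideanSpace ℝ (Fin (m + 1)) → ℝ)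
        (_ : (T.lagrangeSpace k).map (traceMap Ω) =
          Submodule.span ℝ (Set.range fun i => traceMap Ω (μ i)))
        (ψ : Fin Np → EuclideanSpace ℝ (Fin (m + 1)) → ℝ)
        (_ : ∀ j, MemLp (ψ j) 2 (surfaceMeasure Ω))
        (u : T.Node k → ℝ) (p : Fin Np → ℝ)
        (_ : (surfaceMatrix Ω μ (T.nodalBasis k)).mulVec u = (surfaceMatrix Ω μ ψ).mulVec p),
        0 ≤ T.meshWidth ∧ 0 ≤ normSq (surfaceMatrix Ω ψ ψ) p ∧
        normSq (Triangulation.boundaryBlock (T.massMatrix k)) (Triangulation.boundaryPart u) ≤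
            c_M * T.meshWidth * normSq (surfaceMatrix Ω ψ ψ) p ∧
        normSq (Triangulation.boundaryBlock (T.stiffnessMatrix k α))
            (Triangulation.boundaryPart u) ≤
            A * c_K * T.meshWidth⁻¹ * normSq (surfaceMatrix Ω ψ ψ) p := by
  obtain ⟨C, hC0, hC⟩ := exists_sum_sq_le_integral_refShape m hk
  set N : ℝ := (((k + 1) ^ (m + 2) : ℕ) : ℝ) with hN
  set V : ℝ := volume.real (Metric.ball (0 : EuclideanSpace ℝ (Fin (m + 1))) 1) with hV
  have hN0 : 0 ≤ N := Nat.cast_nonneg _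
  have hV0 : 0 ≤ V := measureReal_nonneg
  -- The products of the upper and lower bounds with `h` removed: `h^{m+1} · h^{-m} = h` for `a`,
  -- and a further `h^{-2}` for `b`. Both are known only to be nonnegative, hence the `+ 1` below.
  set a := N * nodalBound k ^ 2 * V * (C * (m * κ) ^ m) with ha
  set b := N * (nodalLipBound k * κ) ^ 2 * V * (C * (m * κ) ^ m) with hb
  have ha0 : 0 ≤ a := by positivity
  have hb0 : 0 ≤ b := by positivity
  refine ⟨a + 1, b + 1, by positivity, by positivity, ?_⟩
  intro Ω hΩ T hT α hα hα0 A hA hαA Nl Np μ hμ ψ hψ u p hup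
  have hproj := Triangulation.integral_femFunction_sq_le hΩ hμ hψ hup
  have hp0 : 0 ≤ normSq (surfaceMatrix Ω ψ ψ) p :=
    (integral_nonneg fun _ => sq_nonneg _).trans hproj
  have hh0 : 0 ≤ T.meshWidth := Real.sSup_nonneg (by
    rintro _ ⟨s, _, rfl⟩; exact Metric.diam_nonneg)
  refine ⟨hh0, hp0, ?_⟩
  -- Without elements the powers of `h` cannot be cancelled, but then there are no nodes and the
  -- left sides are zero.
  rcases T.cells.eq_empty_or_nonempty with he | ⟨s, hs⟩
  · have : IsEmpty (T.BoundaryNode k) := ⟨fun a => by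
      obtain ⟨s, hs, -⟩ := Triangulation.exists_cell_superset a.1.2.1
      rw [he] at hs
      exact hs⟩
    simp only [normSq, dotProduct, Finset.univ_eq_empty, Finset.sum_empty] at hp0 ⊢
    constructor <;> positivity
  have hh : 0 < T.meshWidth := Triangulation.meshWidth_pos (Nat.succ_ne_zero m) hs
  set h := T.meshWidth with hhdef
  set P := normSq (surfaceMatrix Ω ψ ψ) p with hP
  have hsum : ∑ a, Triangulation.boundaryPart u a ^ 2 ≤ C * (m * κ / h) ^ m * P :=
    (Triangulation.sum_sq_boundary_le hk hΩ hC0.le hC hT hκ u).trans (by gcongr)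
  constructor
  · refine (Triangulation.normSq_boundaryBlock_massMatrix_le hk _).trans ?_
    calc 1 * N * nodalBound k ^ 2 * (h ^ (m + 1) * V) *
          ∑ a, Triangulation.boundaryPart u a ^ 2
        ≤ 1 * N * nodalBound k ^ 2 * (h ^ (m + 1) * V) * (C * (m * κ / h) ^ m * P) := by gcongr
      _ = a * h * P := by
        rw [ha, div_pow]; field_simp; ring
      _ ≤ (a + 1) * h * P := by gcongr; linarith
  · refine (Triangulation.normSq_boundaryBlock_stiffnessMatrix_le hk hκ hT hA hα hα0 hαA _).trans ?_
    calc A * N * (nodalLipBound k / (h / κ)) ^ 2 * (h ^ (m + 1) * V) *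
          ∑ a, Triangulation.boundaryPart u a ^ 2
        ≤ A * N * (nodalLipBound k / (h / κ)) ^ 2 * (h ^ (m + 1) * V) *
          (C * (m * κ / h) ^ m * P) := by gcongr
      _ = A * b * h⁻¹ * P := by
        rw [hb, div_pow (m * κ : ℝ)]; field_simp; ring
      _ ≤ A * (b + 1) * h⁻¹ * P := by gcongr; linarith

end BulkSurface
end

open BulkSurface in
theorem mainTheorem6 (k : ℕ) (hk : 1 ≤ k) (κ : ℝ) (hκ : 0 < κ) :
    ∃ c_M : ℝ, 0 < c_M ∧ ∀ A : ℝ, 0 < A → ∃ c_K : ℝ, 0 < c_K ∧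
      ∀ (d : ℕ) (_ : d = 2 ∨ d = 3)
        (Ω : Set (EuclideanSpace ℝ (Fin d))) (_ : IsOpen Ω) (_ : interior (closure Ω) = Ω)
        (T : Triangulation d Ω) (_ : T.QuasiUniform κ)
        (α : EuclideanSpace ℝ (Fin d) → ℝ)
        (_ : AEStronglyMeasurable α (volume.restrict Ω))
        (_ : ∃ α₀ : ℝ, 0 < α₀ ∧ ∀ᵐ x ∂(volume.restrict Ω), α₀ ≤ α x)
        (_ : ∀ᵐ x ∂(volume.restrict Ω), α x ≤ A)
        (Nl Np : ℕ)
        (μ : Fin Nl → EuclideanSpace ℝ (Fin d) → ℝ)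
        (_ : (T.lagrangeSpace k).map (traceMap Ω) =
          Submodule.span ℝ (Set.range fun i => traceMap Ω (μ i)))
        (ψ : Fin Np → EuclideanSpace ℝ (Fin d) → ℝ)
        (_ : ∀ j, MemLp (ψ j) 2 (surfaceMeasure Ω))
        (u : T.Node k → ℝ) (p : Fin Np → ℝ)
        (_ : (surfaceMatrix Ω μ (T.nodalBasis k)).mulVec u = (surfaceMatrix Ω μ ψ).mulVec p),
        normSq (Triangulation.boundaryBlock (T.massMatrix k)) (Triangulation.boundaryPart u) ≤
            c_M * T.meshWidth * normSq (surfaceMatrix Ω ψ ψ) p ∧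
        normSq (Triangulation.boundaryBlock (T.stiffnessMatrix k α))
            (Triangulation.boundaryPart u) ≤
            c_K * T.meshWidth⁻¹ * normSq (surfaceMatrix Ω ψ ψ) p := by
  -- Here `m = d - 1`. The constants for the two dimensions are added, so that one pair serves both.
  obtain ⟨a₁, b₁, ha₁, hb₁, h₁⟩ := exists_boundary_constants 1 k hk κ hκ
  obtain ⟨a₂, b₂, ha₂, hb₂, h₂⟩ := exists_boundary_constants 2 k hk κ hκ
  refine ⟨a₁ + a₂, by positivity, fun A hA => ⟨A * (b₁ + b₂), by positivity, ?_⟩⟩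
  rintro d (rfl | rfl) Ω - hΩ T hT α hα ⟨α₀, hα₀, hα0⟩ hαA Nl Np μ hμ ψ hψ u p hup
  · obtain ⟨hh, hp, hM, hK⟩ := h₁ Ω hΩ T hT α hα (hα0.mono fun x hx => hα₀.le.trans hx) A hA.le hαA
      Nl Np μ hμ ψ hψ u p hup
    refine ⟨hM.trans ?_, hK.trans ?_⟩ <;> gcongr <;> linarith
  · obtain ⟨hh, hp, hM, hK⟩ := h₂ Ω hΩ T hT α hα (hα0.mono fun x hx => hα₀.le.trans hx) A hA.le hαA
      Nl Np μ hμ ψ hψ u p hup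
    refine ⟨hM.trans ?_, hK.trans ?_⟩ <;> gcongr <;> linarith
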